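/- Let $n\ge 2$ and let $B_n$ be the group of real invertible upper triangular $n\times n$ matrices. Let $B_n^+\subset B_n$ be the set of totally positive matrices, i.e. those $G\in B_n$ for which every minor that does not vanish identically on $B_n$ is positive. For $I,J\subset\{1,\dots,n\}$ let $\Delta_I(G)$ be the minor of $G$ with rows $I$ and the last $|I|$ columns, let $\Delta^J(G)$ be the minor with the first $|J|$ rows and columns $J$, and put $\Delta_\emptyset=\Delta^\emptyset=1$ and $\bar I=\{n+1-a : a\in I\}$. Write $[a,b]=\{i\in\mathbb N : a\le i\le b\}$ (empty if $b<a$), and let $$l(x)=\frac{6}{\pi^2}L\Bigl(\frac{x}{1+x}\Bigr)\quad(x>0),\qquad L(x)=\sum_{k\ge1}\frac{x^k}{k^2}+\frac12\log x\,\log(1-x)\quad(0<x<1).$$ For $1\le a<b<c\le n$ set (all minors being those of the matrix $G$) $$Y_{abc}=\frac{\Delta_{[a,b-1]\cup[c+1,n]}\,\Delta_{[a+1,b]\cup[c,n]}}{\Delta_{[a,b]\cup[c+1,n]}\,\Delta_{[a+1,b-1]\cup[c,n]}},\qquad \tilde Y_{abc}=\frac{\Delta_{[1,a]\cup[b+1,c-1]}\,\Delta_{[1,a-1]\cup[b,c]}}{\Delta_{[1,a]\cup[b,c-1]}\,\Delta_{[1,a-1]\cup[b+1,c]}},$$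 $$Y^{abc}=\frac{\Delta^{[a,b]\cup[c+1,n]}\,\Delta^{[a+1,b-1]\cup[c,n]}}{\Delta^{[a,b-1]\cup[c+1,n]}\,\Delta^{[a+1,b]\cup[c,n]}},\qquad \tilde Y^{abc}=\frac{\Delta^{[1,a]\cup[b,c-1]}\,\Delta^{[1,a-1]\cup[b+1,c]}}{\Delta^{[1,a]\cup[b+1,c-1]}\,\Delta^{[1,a-1]\cup[b,c]}}.$$ **Theorem.** For every $G\in B_n^+$ there are a unique $\check G\in B_n^+$ with $\Delta_I(\check G)=\Delta_{\bar I}(G)$ for all $I\subset\{1,\dots,n\}$ and a unique $\hat G\in B_n^+$ with $\Delta^J(\hat G)=\Delta^{\bar J}(G)$ for all $J\subset\{1,\dots,n\}$, and, all sums being over the triples of integers $1\le a<b<c\le n$, $$\begin{aligned} &\sum l\bigl(Y_{abc}(\check G)\bigr)=\sum l\Bigl(\frac1{Y_{abc}(G)}\Bigr)=\sum l\bigl(Y_{abc}(\hat G)\bigr)\\ ={}&\sum l\bigl(\tilde Y^{abc}(\check G)\bigr)=\sum l\Bigl(\frac1{\tilde Y^{abc}(G)}\Bigr)=\sum l\bigl(\tilde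 Y^{abc}(\hat G)\bigr)\\ ={}&\sum l\bigl(\tilde Y_{abc}(\check G)\bigr)=\sum l\Bigl(\frac1{\tilde Y_{abc}(G)}\Bigr)=\sum l\bigl(\tilde Y_{abc}(\hat G)\bigr)\\ ={}&\sum l\bigl(Y^{abc}(\check G)\bigr)=\sum l\Bigl(\frac1{Y^{abc}(G)}\Bigr)=\sum l\bigl(Y^{abc}(\hat G)\bigr). \end{aligned}$$ -/

import Mathlib

open scoped BigOperators

namespace TotPosDilog

/-- The dilogarithm `Li₂(x) = ∑_{k ≥ 1} x ^ k / k ^ 2` (convergent for `|x| ≤ 1`). -/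
noncomputable def Li2 (x : ℝ) : ℝ := ∑' k : ℕ, x ^ (k + 1) / ((k : ℝ) + 1) ^ 2

/-- The Rogers dilogarithm; used only for `0 < x < 1`. -/
noncomputable def rogersL (x : ℝ) : ℝ := Li2 x + 1 / 2 * Real.log x * Real.log (1 - x)

/-- The function `l(x) = (6 / π²) L(x / (1 + x))`; used only for `x > 0`. -/
noncomputable def ell (x : ℝ) : ℝ := 6 / Real.pi ^ 2 * rogersL (x / (1 + x))

/-- `B_n`: the real invertible upper triangular `n × n` matrices. -/
def B (n : ℕ) : Set (Matrix (Fin n) (Fin n) ℝ) :=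
  {G | (∀ i j : Fin n, j < i → G i j = 0) ∧ IsUnit G}

/-- `B_n⁺`: those `G ∈ B_n` for which every minor (rows `r 0 < r 1 < ⋯`, columns
`c 0 < c 1 < ⋯`) that does not vanish identically on `B_n` is positive. -/
def BPlus (n : ℕ) : Set (Matrix (Fin n) (Fin n) ℝ) :=
  {G | G ∈ B n ∧ ∀ (k : ℕ) (r c : Fin k ↪o Fin n),
    (∃ H ∈ B n, (H.submatrix r c).det ≠ 0) → 0 < (G.submatrix r c).det}

/-- The right flag minor `Δ_I(G)`: rows in `I` (in increasing order), last `|I|` columns. -/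
noncomputable def rightMinor {n : ℕ} (G : Matrix (Fin n) (Fin n) ℝ) (I : Finset (Fin n)) : ℝ :=
  (Matrix.of fun i j : Fin I.card =>
    G (I.orderEmbOfFin rfl i)
      ⟨n - I.card + j, by have := I.card_le_univ; have := j.2; simp at *; omega⟩).det

/-- The upper flag minor `Δ^J(G)`: first `|J|` rows, columns in `J` (in increasing order). -/
noncomputable def upperMinor {n : ℕ} (G : Matrix (Fin n) (Fin n) ℝ) (J : Finset (Fin n)) : ℝ :=
  (Matrix.of fun i j : Fin J.card =>
    G ⟨i, by have := J.card_le_univ; have := i.2; simp at *; omega⟩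
      (J.orderEmbOfFin rfl j)).det

/-- The reversed index set `Ī = {n + 1 - a | a ∈ I}`. -/
def bar {n : ℕ} (I : Finset (Fin n)) : Finset (Fin n) := I.image Fin.rev

/-- `H` is `Ǧ`: it lies in `B_n⁺` and `Δ_I(H) = Δ_Ī(G)` for all `I`. -/
def IsCheck {n : ℕ} (G H : Matrix (Fin n) (Fin n) ℝ) : Prop :=
  H ∈ BPlus n ∧ ∀ I : Finset (Fin n), rightMinor H I = rightMinor G (bar I)

/-- `H` is `Ĝ`: it lies in `B_n⁺` and `Δ^J(H) = Δ^J̄(G)` for all `J`. -/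
def IsHat {n : ℕ} (G H : Matrix (Fin n) (Fin n) ℝ) : Prop :=
  H ∈ BPlus n ∧ ∀ J : Finset (Fin n), upperMinor H J = upperMinor G (bar J)

/-- The interval `[a, b]` of the one-based labels `1, …, n`, as a set of zero-based indices;
it is empty if `b < a`. -/
def seg (n a b : ℕ) : Finset (Fin n) :=
  Finset.univ.filter fun i : Fin n => a ≤ (i : ℕ) + 1 ∧ (i : ℕ) + 1 ≤ b

/-- The discrete tetrahedron: the triples `1 ≤ a < b < c ≤ n`. -/
def T (n : ℕ) : Finset (ℕ × ℕ × ℕ) :=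
  (Finset.Icc 1 n ×ˢ Finset.Icc 1 n ×ˢ Finset.Icc 1 n).filter
    fun t => t.1 < t.2.1 ∧ t.2.1 < t.2.2

variable {n : ℕ}

/-- `Y_{abc}(G)`. -/
noncomputable def Ylow (G : Matrix (Fin n) (Fin n) ℝ) (a b c : ℕ) : ℝ :=
  (rightMinor G (seg n a (b - 1) ∪ seg n (c + 1) n) *
      rightMinor G (seg n (a + 1) b ∪ seg n c n)) /
    (rightMinor G (seg n a b ∪ seg n (c + 1) n) *
      rightMinor G (seg n (a + 1) (b - 1) ∪ seg n c n))

/-- `Ỹ_{abc}(G)`. -/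
noncomputable def Ytlow (G : Matrix (Fin n) (Fin n) ℝ) (a b c : ℕ) : ℝ :=
  (rightMinor G (seg n 1 a ∪ seg n (b + 1) (c - 1)) *
      rightMinor G (seg n 1 (a - 1) ∪ seg n b c)) /
    (rightMinor G (seg n 1 a ∪ seg n b (c - 1)) *
      rightMinor G (seg n 1 (a - 1) ∪ seg n (b + 1) c))

/-- `Y^{abc}(G)`. -/
noncomputable def Yup (G : Matrix (Fin n) (Fin n) ℝ) (a b c : ℕ) : ℝ :=
  (upperMinor G (seg n a b ∪ seg n (c + 1) n) *
      upperMinor G (seg n (a + 1) (b - 1) ∪ seg n c n)) /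
    (upperMinor G (seg n a (b - 1) ∪ seg n (c + 1) n) *
      upperMinor G (seg n (a + 1) b ∪ seg n c n))

/-- `Ỹ^{abc}(G)`. -/
noncomputable def Ytup (G : Matrix (Fin n) (Fin n) ℝ) (a b c : ℕ) : ℝ :=
  (upperMinor G (seg n 1 a ∪ seg n b (c - 1)) *
      upperMinor G (seg n 1 (a - 1) ∪ seg n (b + 1) c)) /
    (upperMinor G (seg n 1 a ∪ seg n (b + 1) (c - 1)) *
      upperMinor G (seg n 1 (a - 1) ∪ seg n b c))

/-- `∑_{(a,b,c) ∈ T_n} l(Z_{abc})`. -/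
noncomputable def dilogSum (n : ℕ) (Z : ℕ → ℕ → ℕ → ℝ) : ℝ :=
  ∑ t ∈ T n, ell (Z t.1 t.2.1 t.2.2)

/-- `∑_{(a,b,c) ∈ T_n} l(1 / Z_{abc})`. -/
noncomputable def dilogSumInv (n : ℕ) (Z : ℕ → ℕ → ℕ → ℝ) : ℝ :=
  ∑ t ∈ T n, ell (1 / Z t.1 t.2.1 t.2.2)

end TotPosDilog

/-! Flag minors of a totally positive matrix are positive and satisfy three-term exchange relations.
Each of the ratios in the theorem, or its inverse, is an exchange ratio of a triple a < b < c over a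
set S of further labels. For four labels p < q < r < s the five-term relation of the dilogarithm,
used twice, yields the tetrahedron identity `ell_tetrahedron`. Moving the labels 1, ..., n across
one at a time (`pathSet`) turns the sets S of the untilded family into those of the tilded one, and
the changes caused by one quadruple cancel by that identity. This gives `dilogSum_Ylow_eq_Ytlow` and
`dilogSumInv_Yup_eq_Ytup`.

Right and upper flag minors are linked by triangularity: up to diagonal entries, those in question
are minors of consecutive rows and columns, and Y_{abc} equals Ỹ^{a,a+c-b,c} (`Ylow_eq_Ytup`). As
l(x) + l(1/x) is constant, the four sums of any totally positive matrix agree, and so do its four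
inverse sums (`dilogSum_all_eq`). Reversing the labels inverts the ratios, so the sums of Ǧ and Ĝ
are inverse sums of G.

The matrix Ĝ arises from G by a signed reversal of columns followed by lower unipotent elimination.
It is totally positive because positive upper flag minors suffice for that
(`mem_BPlus_of_upperMinor_pos`), and unique because its entries are determined by these minors.
Reflection in the antidiagonal carries everything over to Ǧ. -/

namespace TotPosDilog

/-! ### Analysis of the dilogarithm: reflection and five-term relation. -/

open Filter Topology Set

/-- The dilogarithm is differentiable inside the unit interval, term by term. -/
theorem hasDerivAt_Li2_tsum {x : ℝ} (hx : |x| < 1) :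
    HasDerivAt Li2 (∑' k : ℕ, x ^ k / ((k : ℝ) + 1)) x := by
  obtain ⟨r, hxr, hr⟩ := exists_between hx
  have hr0 : 0 ≤ r := (abs_nonneg x).trans hxr.le
  refine hasDerivAt_tsum_of_isPreconnected (t := Ioo (-r) r) (y₀ := 0)
    (u := fun k : ℕ => r ^ k) (g := fun (k : ℕ) (x : ℝ) => x ^ (k + 1) / ((k : ℝ) + 1) ^ 2)
    (g' := fun (k : ℕ) (x : ℝ) => x ^ k / ((k : ℝ) + 1))
    (summable_geometric_of_lt_one hr0 hr) isOpen_Ioo isPreconnected_Ioo ?_ ?_ ?_ ?_ ?_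
  · intro k y _
    have h := (hasDerivAt_pow (k + 1) y).div_const (((k : ℝ) + 1) ^ 2)
    have hk : (k : ℝ) + 1 ≠ 0 := by positivity
    refine h.congr_deriv ?_
    push_cast
    field_simp
  · intro k y hy
    have hy' : |y| ≤ r := (abs_lt.2 ⟨hy.1, hy.2⟩).le
    rw [Real.norm_eq_abs, abs_div, abs_pow, abs_of_pos (by positivity : (0 : ℝ) < (k : ℝ) + 1)]
    calc |y| ^ k / ((k : ℝ) + 1) ≤ |y| ^ k :=
          div_le_self (by positivity) (by linarith [Nat.cast_nonneg (α := ℝ) k])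
      _ ≤ r ^ k := pow_le_pow_left₀ (abs_nonneg y) hy' k
  · have : 0 < r := (abs_nonneg x).trans_lt hxr
    exact ⟨by linarith, this⟩
  · simp
  · exact abs_lt.1 hxr

theorem hasDerivAt_Li2 {x : ℝ} (hx0 : 0 < x) (hx1 : x < 1) :
    HasDerivAt Li2 (-Real.log (1 - x) / x) x := by
  have hx : |x| < 1 := by rw [abs_of_pos hx0]; exact hx1
  convert hasDerivAt_Li2_tsum hx using 1
  have h := (Real.hasSum_pow_div_log_of_abs_lt_one hx).div_const x
  rw [← h.tsum_eq]
  refine tsum_congr fun k => ?_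
  field_simp
  ring

theorem hasDerivAt_rogersL {x : ℝ} (hx0 : 0 < x) (hx1 : x < 1) :
    HasDerivAt rogersL (-(1 / 2) * (Real.log (1 - x) / x + Real.log x / (1 - x))) x := by
  have h1 : HasDerivAt (fun x : ℝ => 1 - x) (-1) x := by
    simpa using (hasDerivAt_id x).const_sub 1
  have h2 := h1.log (by linarith : (1 : ℝ) - x ≠ 0)
  have h3 := (((Real.hasDerivAt_log hx0.ne').const_mul (1 / 2 : ℝ)).mul h2)
  have h4 := (hasDerivAt_Li2 hx0 hx1).add h3
  refine h4.congr_deriv ?_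
  have : 1 - x ≠ 0 := by linarith
  field_simp
  ring

theorem hasDerivAt_ell {y : ℝ} (hy : 0 < y) :
    HasDerivAt ell (3 / Real.pi ^ 2 * (Real.log (1 + y) / y - Real.log y / (1 + y))) y := by
  have hy1 : 0 < 1 + y := by linarith
  have h1 : HasDerivAt (fun y : ℝ => y / (1 + y)) (1 / (1 + y) ^ 2) y := by
    have h := (hasDerivAt_id y).div ((hasDerivAt_id y).const_add 1) hy1.ne'
    refine h.congr_deriv ?_
    simp
  have hx0 : 0 < y / (1 + y) := by positivity
  have hx1 : y / (1 + y) < 1 := by rw [div_lt_one hy1]; linarith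
  have h2 := ((hasDerivAt_rogersL hx0 hx1).comp y h1).const_mul (6 / Real.pi ^ 2)
  refine h2.congr_deriv ?_
  have e : 1 - y / (1 + y) = 1 / (1 + y) := by field_simp; ring
  rw [e, Real.log_div hy.ne' hy1.ne', one_div (1 + y), Real.log_inv]
  have := Real.pi_ne_zero
  field_simp
  ring

/-- The logarithmic term is half of (x log x) · (log(1 - x) / x), whose factors tend to 0 and -1. -/
theorem tendsto_rogersL_zero : Tendsto rogersL (𝓝[>] 0) (𝓝 0) := by
  have h1 : Tendsto Li2 (𝓝[>] 0) (𝓝 0) := by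
    have h := (hasDerivAt_Li2_tsum (x := 0) (by simp)).continuousAt.tendsto
    have e : Li2 0 = 0 := by simp [Li2]
    rw [e] at h
    exact h.mono_left nhdsWithin_le_nhds
  have h2 : Tendsto (fun x : ℝ => Real.log (1 - x) / x) (𝓝[>] 0) (𝓝 (-1)) := by
    have hd : HasDerivAt (fun x : ℝ => Real.log (1 - x)) (-1) 0 := by
      have h1 : HasDerivAt (fun x : ℝ => 1 - x) (-1) 0 := by
        simpa using (hasDerivAt_id (0 : ℝ)).const_sub 1
      simpa using h1.log (by norm_num)
    have h := (hasDerivAt_iff_tendsto_slope.1 hd).mono_left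
      (nhdsWithin_mono (0 : ℝ) (fun x (hx : 0 < x) => hx.ne'))
    refine h.congr fun x => ?_
    simp [slope_def_field]
  have h3 : Tendsto (fun x : ℝ => x * Real.log x) (𝓝[>] 0) (𝓝 0) := by
    have h := (Real.continuous_mul_log.tendsto 0).mono_left
      (nhdsWithin_le_nhds (s := Ioi (0 : ℝ)))
    simpa using h
  have h4 := h1.add ((h3.mul h2).const_mul (1 / 2))
  simp only [zero_mul, mul_zero, add_zero] at h4
  refine h4.congr' ?_
  filter_upwards [self_mem_nhdsWithin] with x hx
  have : x ≠ 0 := ne_of_gt hx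
  rw [rogersL]
  field_simp

theorem tendsto_ell_comp_zero {f : ℝ → ℝ} {a : ℝ} (hf : ContinuousAt f a) (h0 : f a = 0)
    (hpos : ∀ x, a < x → 0 < f x) : Tendsto (fun x => ell (f x)) (𝓝[>] a) (𝓝 0) := by
  have h1 : Tendsto (fun x => f x / (1 + f x)) (𝓝[>] a) (𝓝[>] 0) := by
    refine tendsto_nhdsWithin_iff.2 ⟨?_, ?_⟩
    · have h : ContinuousAt (fun x => f x / (1 + f x)) a :=
        hf.div (continuousAt_const.add hf) (by simp [h0])
      have h' := h.tendsto.mono_left (nhdsWithin_le_nhds (s := Ioi a))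
      simpa [h0] using h'
    · filter_upwards [self_mem_nhdsWithin] with x hx
      have := hpos x hx
      show 0 < f x / (1 + f x)
      positivity
  have h2 := (tendsto_rogersL_zero.comp h1).const_mul (6 / Real.pi ^ 2)
  simpa [ell, Function.comp_def] using h2

theorem eq_of_hasDerivAt_zero {f : ℝ → ℝ} (h : ∀ x, 0 < x → HasDerivAt f 0 x) {x y : ℝ}
    (hx : 0 < x) (hy : 0 < y) : f x = f y :=
  isOpen_Ioi.is_const_of_deriv_eq_zero isPreconnected_Ioi
    (fun z hz => (h z hz).differentiableAt.differentiableWithinAt)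
    (fun z hz => (h z hz).deriv) hx hy

/-- The reflection formula, with an unspecified constant. -/
theorem exists_ell_reflection : ∃ C : ℝ, ∀ x, 0 < x → ell x + ell (1 / x) = C := by
  refine ⟨ell 1 + ell (1 / 1), fun x hx => ?_⟩
  refine eq_of_hasDerivAt_zero (f := fun x => ell x + ell (1 / x)) (fun x hx => ?_) hx one_pos
  have h1 : HasDerivAt (fun x : ℝ => 1 / x) (-(x ^ 2)⁻¹) x := by
    simpa using hasDerivAt_inv hx.ne'
  have h2 := (hasDerivAt_ell hx).add
    ((hasDerivAt_ell (by positivity : 0 < 1 / x)).comp x h1)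
  refine h2.congr_deriv ?_
  have hx1 : 0 < 1 + x := by linarith
  have e : 1 + 1 / x = (1 + x) / x := by field_simp; ring
  rw [e, Real.log_div hx1.ne' hx.ne', one_div, Real.log_inv]
  have := Real.pi_ne_zero
  field_simp
  ring

/-- For fixed v, the terms involving w combine to a function with zero derivative in w; its value is
found by letting w tend to 0 from the right, where every term but l(v + w) vanishes. -/
theorem ell_five_term_normalized {v w : ℝ} (hv : 0 < v) (hw : 0 < w) :
    ell (v + w) + ell (w / v) = ell v + ell (w / (1 + v)) + ell (w / (v * (1 + v + w))) := by
  set D : ℝ → ℝ := fun w => ell (v + w) + ell (w / v) -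
    (ell (w / (1 + v)) + ell (w / (v * (1 + v + w)))) with hD
  have hderiv : ∀ w, 0 < w → HasDerivAt D 0 w := by
    intro w hw
    have hvw : 0 < v + w := by positivity
    have hs : 0 < 1 + v + w := by positivity
    have hv1 : 0 < 1 + v := by positivity
    have d1 := (hasDerivAt_ell hvw).comp w ((hasDerivAt_id w).const_add v)
    have d2 := (hasDerivAt_ell (div_pos hw hv)).comp w ((hasDerivAt_id w).div_const v)
    have d3 := (hasDerivAt_ell (div_pos hw hv1)).comp w ((hasDerivAt_id w).div_const (1 + v))
    have d4 := (hasDerivAt_ell (div_pos hw (mul_pos hv hs))).comp w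
      ((hasDerivAt_id w).div (((hasDerivAt_id w).const_add (1 + v)).const_mul v)
        (mul_pos hv hs).ne')
    have d := (d1.add d2).sub (d3.add d4)
    refine d.congr_deriv ?_
    have e1 : 1 + (v + w) = 1 + v + w := by ring
    have e2 : 1 + w / v = (v + w) / v := by field_simp
    have e3 : 1 + w / (1 + v) = (1 + v + w) / (1 + v) := by field_simp
    have e4 : 1 + w / (v * (1 + v + w)) = (1 + v) * (v + w) / (v * (1 + v + w)) := by
      field_simp; ring
    simp only [id]
    rw [e1, e2, e3, e4, Real.log_div hvw.ne' hv.ne', Real.log_div hw.ne' hv.ne',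
      Real.log_div hs.ne' hv1.ne', Real.log_div hw.ne' hv1.ne',
      Real.log_div (mul_pos hv1 hvw).ne' (mul_pos hv hs).ne',
      Real.log_div hw.ne' (mul_pos hv hs).ne', Real.log_mul hv1.ne' hvw.ne',
      Real.log_mul hv.ne' hs.ne']
    have := Real.pi_ne_zero
    field_simp
    ring
  have hlim : Tendsto D (𝓝[>] 0) (𝓝 (ell v)) := by
    have t1 : Tendsto (fun w => ell (v + w)) (𝓝[>] 0) (𝓝 (ell v)) := by
      have hc : ContinuousAt (fun w => ell (v + w)) 0 := by
        have : ContinuousAt ell (v + 0) := by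
          simpa using (hasDerivAt_ell hv).continuousAt
        exact ContinuousAt.comp (f := fun w : ℝ => v + w) this (by fun_prop)
      simpa using hc.tendsto.mono_left (nhdsWithin_le_nhds (s := Ioi (0 : ℝ)))
    have t2 := tendsto_ell_comp_zero (f := fun w => w / v) (a := 0) (by fun_prop) (by simp)
      (fun x hx => div_pos hx hv)
    have t3 := tendsto_ell_comp_zero (f := fun w => w / (1 + v)) (a := 0) (by fun_prop) (by simp)
      (fun x hx => by positivity)
    have t4 := tendsto_ell_comp_zero (f := fun w => w / (v * (1 + v + w))) (a := 0)
      (ContinuousAt.div (by fun_prop) (by fun_prop) (by simp; constructor <;> positivity))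
      (by simp) (fun x hx => by positivity)
    simpa using (t1.add t2).sub (t3.add t4)
  have hconst : Tendsto D (𝓝[>] 0) (𝓝 (D w)) := by
    refine tendsto_const_nhds.congr' ?_
    filter_upwards [self_mem_nhdsWithin] with x hx
    exact eq_of_hasDerivAt_zero hderiv hw hx
  have h := tendsto_nhds_unique hconst hlim
  simp only [hD] at h
  linarith

/-- The five-term relation of the dilogarithm, in homogeneous form. -/
theorem ell_five_term {u v w : ℝ} (hu : 0 < u) (hv : 0 < v) (hw : 0 < w) :
    ell ((v + w) / u) + ell (w / v) =
      ell (v / u) + ell (w / (u + v)) + ell (u * w / ((u + v + w) * v)) := by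
  have h := ell_five_term_normalized (div_pos hv hu) (div_pos hw hu)
  convert h using 3
  · field_simp
  · field_simp
  · congr 1; field_simp
  · field_simp

end TotPosDilog

/-! ### Exchange ratios and invariance of the dilogarithm sum along a path of sets. -/

namespace TotPosDilog

/-- The exchange ratio `F(S ∪ a) F(S ∪ bc) / (F(S ∪ ab) F(S ∪ c))`. -/
noncomputable def exchangeRatio (F : Set ℕ → ℝ) (S : Set ℕ) (a b c : ℕ) : ℝ :=
  (F (insert a S) * F (insert b (insert c S))) / (F (insert a (insert b S)) * F (insert c S))

/-- The three-term exchange relations for `F` on the labels `1, …, n`. -/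
def ThreeTerm (n : ℕ) (F : Set ℕ → ℝ) : Prop :=
  ∀ (S : Set ℕ) (a b c : ℕ), 1 ≤ a → a < b → b < c → c ≤ n → a ∉ S → b ∉ S → c ∉ S →
    F (insert b S) * F (insert a (insert c S)) =
      F (insert a S) * F (insert b (insert c S)) + F (insert c S) * F (insert a (insert b S))

/-- The pentagon identity for two-level functions satisfying the three-term relations. -/
theorem ell_pentagon {f1 f2 f3 f4 f12 f13 f14 f23 f24 f34 : ℝ}
    (h1 : 0 < f1) (h2 : 0 < f2) (h3 : 0 < f3) (h4 : 0 < f4)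
    (h12 : 0 < f12) (h23 : 0 < f23) (h34 : 0 < f34)
    (r123 : f2 * f13 = f1 * f23 + f3 * f12) (r124 : f2 * f14 = f1 * f24 + f4 * f12)
    (r134 : f3 * f14 = f1 * f34 + f4 * f13) :
    ell (f1 * f24 / (f12 * f4)) + ell (f2 * f34 / (f23 * f4)) =
      ell (f1 * f23 / (f12 * f3)) + ell (f1 * f34 / (f13 * f4)) +
        ell (f12 * f34 / (f14 * f23)) := by
  -- The three-term relations say that the numbers fij / (fi fj) add up like distances of four
  -- points on a line; u, v, w are the consecutive gaps.
  have h := ell_five_term (u := f12 / (f1 * f2)) (v := f23 / (f2 * f3)) (w := f34 / (f3 * f4))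
    (by positivity) (by positivity) (by positivity)
  have e13 : f13 = (f1 * f23 + f3 * f12) / f2 := by field_simp; linarith
  have e14 : f14 = (f1 * f34 + f4 * f13) / f3 := by field_simp; linarith
  -- The relation for the labels 2, 3, 4 follows from the other three.
  have e24 : f24 = (f2 * f34 + f4 * f23) / f3 := by
    have : f1 * f24 = f1 * ((f2 * f34 + f4 * f23) / f3) := by
      have h := r124
      rw [e14, e13] at h
      field_simp at h ⊢
      refine mul_left_cancel₀ h1.ne' ?_
      linear_combination -h
    exact mul_left_cancel₀ h1.ne' this
  have hp : 0 < f1 * f23 + f3 * f12 := by positivity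
  have hq : 0 < f1 * (f2 * f34) + f4 * (f1 * f23 + f3 * f12) := by positivity
  convert h using 3
  · rw [e24]; field_simp; ring
  · field_simp
  · congr 1; field_simp
  · rw [e13]; field_simp; ring_nf
  · rw [e14, e13]; field_simp; ring

/-- The tetrahedron identity: both sides run over the four triples in `{p, q, r, s}`. -/
theorem ell_tetrahedron {n : ℕ} {F : Set ℕ → ℝ} (hpos : ∀ S, 0 < F S) (hF : ThreeTerm n F)
    {B : Set ℕ} {p q r s : ℕ} (hp1 : 1 ≤ p) (hpq : p < q) (hqr : q < r) (hrs : r < s)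
    (hsn : s ≤ n) (hp : p ∉ B) (hq : q ∉ B) (hr : r ∉ B) (hs : s ∉ B) :
    ell (exchangeRatio F B q r s) + ell (exchangeRatio F (insert q B) p r s) +
        ell (exchangeRatio F B p q s) + ell (exchangeRatio F (insert s B) p q r) =
      ell (exchangeRatio F (insert p B) q r s) + ell (exchangeRatio F B p r s) +
        ell (exchangeRatio F (insert r B) p q s) + ell (exchangeRatio F B p q r) := by
  have key1 := ell_pentagon (hpos (insert p B)) (hpos (insert q B)) (hpos (insert r B))
    (hpos (insert s B)) (hpos (insert p (insert q B)))
    (hpos (insert q (insert r B))) (hpos (insert r (insert s B)))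
    (hF B p q r hp1 hpq hqr (by omega) hp hq hr)
    (hF B p q s hp1 hpq (by omega) hsn hp hq hs)
    (hF B p r s hp1 (by omega) hrs hsn hp hr hs)
  have s1 := hF (insert s B) p q r hp1 hpq hqr (by omega)
    (by simp [hp]; omega) (by simp [hq]; omega) (by simp [hr]; omega)
  have s2 := hF (insert r B) p q s hp1 hpq (by omega) hsn
    (by simp [hp]; omega) (by simp [hq]; omega) (by simp [hs]; omega)
  have s3 := hF (insert q B) p r s hp1 (by omega) hrs hsn
    (by simp [hp]; omega) (by simp [hr]; omega) (by simp [hs]; omega)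
  have s4 := hF (insert p B) q r s (by omega) hqr hrs hsn
    (by simp [hq]; omega) (by simp [hr]; omega) (by simp [hs]; omega)
  have c1 : ∀ S : Set ℕ, insert q (insert p S) = insert p (insert q S) :=
    fun S => Set.insert_comm _ _ _
  have c2 : ∀ S : Set ℕ, insert r (insert p S) = insert p (insert r S) :=
    fun S => Set.insert_comm _ _ _
  have c3 : ∀ S : Set ℕ, insert s (insert p S) = insert p (insert s S) :=
    fun S => Set.insert_comm _ _ _
  have c4 : ∀ S : Set ℕ, insert r (insert q S) = insert q (insert r S) :=
    fun S => Set.insert_comm _ _ _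
  have c5 : ∀ S : Set ℕ, insert s (insert q S) = insert q (insert s S) :=
    fun S => Set.insert_comm _ _ _
  have c6 : ∀ S : Set ℕ, insert s (insert r S) = insert r (insert s S) :=
    fun S => Set.insert_comm _ _ _
  simp only [c1, c2, c3, c4, c5, c6] at s1 s2 s3 s4
  -- The second pentagon replaces each subset of {p, q, r, s} by its complement. Its last term
  -- coincides with that of `key1`, so it drops out of the difference.
  have key2 := ell_pentagon (hpos (insert q (insert r (insert s B))))
    (hpos (insert p (insert r (insert s B)))) (hpos (insert p (insert q (insert s B))))
    (hpos (insert p (insert q (insert r B))))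
    (f12 := F (insert r (insert s B))) (f13 := F (insert q (insert s B)))
    (f14 := F (insert q (insert r B))) (f23 := F (insert p (insert s B)))
    (f24 := F (insert p (insert r B))) (f34 := F (insert p (insert q B)))
    (hpos _) (hpos _) (hpos _) (by linarith) (by linarith) (by linarith)
  simp only [exchangeRatio, c1, c2, c3, c4, c5, c6]
  simp only [mul_comm] at key1 key2 ⊢
  linarith

/-- The sets `S` attached to `a < b < c` along the path of exchanges: labels up to `m` have
already been moved across. -/
def pathSet (a b c m : ℕ) : Set ℕ :=
  {y | (y < a ∧ y ≤ m) ∨ (a < y ∧ y < b ∧ m < y) ∨ (b < y ∧ y < c ∧ y ≤ m) ∨ (c < y ∧ m < y)}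

theorem sum_T (n : ℕ) (f : ℕ → ℕ → ℕ → ℝ) :
    ∑ t ∈ T n, f t.1 t.2.1 t.2.2 =
      ∑ a ∈ Finset.Icc 1 n, ∑ b ∈ Finset.Icc 1 n, ∑ c ∈ Finset.Icc 1 n,
        if a < b ∧ b < c then f a b c else 0 := by
  rw [T, Finset.sum_filter, Finset.sum_product]
  refine Finset.sum_congr rfl fun a _ => ?_
  rw [Finset.sum_product]

theorem sum_T_congr {n : ℕ} {f g : ℕ → ℕ → ℕ → ℝ}
    (h : ∀ a b c, 1 ≤ a → a < b → b < c → c ≤ n → f a b c = g a b c) :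
    ∑ t ∈ T n, f t.1 t.2.1 t.2.2 = ∑ t ∈ T n, g t.1 t.2.1 t.2.2 := by
  refine Finset.sum_congr rfl fun t ht => ?_
  simp only [T, Finset.mem_filter, Finset.mem_product, Finset.mem_Icc] at ht
  exact h _ _ _ (by omega) ht.2.1 ht.2.2 (by omega)

/-- A sum over triples and a fourth label vanishes if it vanishes on each quadruple. -/
theorem sum_T_sum_eq_zero (n : ℕ) (h : ℕ → ℕ → ℕ → ℕ → ℝ)
    (hdiag : ∀ a b c m, a < b → b < c → m = a ∨ m = b ∨ m = c → h a b c m = 0)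
    (hquad : ∀ p q r s, 1 ≤ p → p < q → q < r → r < s → s ≤ n →
      h q r s p + h p r s q + h p q s r + h p q r s = 0) :
    ∑ t ∈ T n, ∑ m ∈ Finset.Icc 1 n, h t.1 t.2.1 t.2.2 m = 0 := by
  rw [sum_T n fun a b c => ∑ m ∈ Finset.Icc 1 n, h a b c m]
  set I := Finset.Icc 1 n with hI
  -- Cut-off to increasing quadruples; the four summands in `split` are the four possible positions
  -- of m relative to a < b < c.
  let k : ℕ → ℕ → ℕ → ℕ → ℝ → ℝ := fun p q r s x => if p < q ∧ q < r ∧ r < s then x else 0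
  have split : ∀ a b c, (if a < b ∧ b < c then ∑ m ∈ I, h a b c m else 0) =
      ∑ m ∈ I, (k m a b c (h a b c m) + k a m b c (h a b c m) + k a b m c (h a b c m) +
        k a b c m (h a b c m)) := by
    intro a b c
    split_ifs with habc
    · refine Finset.sum_congr rfl fun m _ => ?_
      obtain ⟨hab, hbc⟩ := habc
      simp only [k]
      rcases lt_trichotomy m a with h1 | h1 | h1
      · simp [h1, hab, hbc, h1.not_gt, (h1.trans hab).not_gt, (h1.trans (hab.trans hbc)).not_gt]
      · simp [hdiag a b c m hab hbc (Or.inl h1)]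
      rcases lt_trichotomy m b with h2 | h2 | h2
      · simp [h1, h2, hab, hbc, h1.not_gt, h2.not_gt, (h2.trans hbc).not_gt]
      · simp [hdiag a b c m hab hbc (Or.inr (Or.inl h2))]
      rcases lt_trichotomy m c with h3 | h3 | h3
      · simp [h1, h2, h3, hab, hbc, h1.not_gt, h2.not_gt, h3.not_gt]
      · simp [hdiag a b c m hab hbc (Or.inr (Or.inr h3))]
      · simp [h1, h2, h3, hab, hbc, h1.not_gt, h2.not_gt, h3.not_gt]
    · symm
      refine Finset.sum_eq_zero fun m _ => ?_
      simp only [k]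
      rw [if_neg (by omega), if_neg (by omega), if_neg (by omega), if_neg (by omega)]
      simp
  simp only [split, Finset.sum_add_distrib]
  have e1 : ∑ a ∈ I, ∑ b ∈ I, ∑ c ∈ I, ∑ m ∈ I, k m a b c (h a b c m) =
      ∑ p ∈ I, ∑ q ∈ I, ∑ r ∈ I, ∑ s ∈ I, k p q r s (h q r s p) :=
    (Finset.sum_congr rfl fun a _ => (Finset.sum_congr rfl fun b _ =>
      Finset.sum_comm).trans Finset.sum_comm).trans Finset.sum_comm
  have e2 : ∑ a ∈ I, ∑ b ∈ I, ∑ c ∈ I, ∑ m ∈ I, k a m b c (h a b c m) =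
      ∑ p ∈ I, ∑ q ∈ I, ∑ r ∈ I, ∑ s ∈ I, k p q r s (h p r s q) :=
    Finset.sum_congr rfl fun a _ => (Finset.sum_congr rfl fun b _ =>
      Finset.sum_comm).trans Finset.sum_comm
  have e3 : ∑ a ∈ I, ∑ b ∈ I, ∑ c ∈ I, ∑ m ∈ I, k a b m c (h a b c m) =
      ∑ p ∈ I, ∑ q ∈ I, ∑ r ∈ I, ∑ s ∈ I, k p q r s (h p q s r) :=
    Finset.sum_congr rfl fun a _ => Finset.sum_congr rfl fun b _ => Finset.sum_comm
  rw [e1, e2, e3]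
  simp only [← Finset.sum_add_distrib]
  refine Finset.sum_eq_zero fun p hp => Finset.sum_eq_zero fun q _ =>
    Finset.sum_eq_zero fun r _ => Finset.sum_eq_zero fun s hs => ?_
  simp only [k]
  split_ifs with hc
  · exact hquad p q r s (Finset.mem_Icc.1 hp).1 hc.1 hc.2.1 hc.2.2 (Finset.mem_Icc.1 hs).2
  · simp

theorem sum_Icc_telescope (f : ℕ → ℝ) (n : ℕ) :
    ∑ m ∈ Finset.Icc 1 n, (f (m - 1) - f m) = f 0 - f n := by
  induction n with
  | zero => simp
  | succ n ih => rw [Finset.sum_Icc_succ_top (by omega), ih]; simp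

/-- The dilogarithm sum does not change along the path of exchanges. -/
theorem sum_ell_exchangeRatio_pathSet {n : ℕ} {F : Set ℕ → ℝ} (hpos : ∀ S, 0 < F S)
    (hF : ThreeTerm n F) :
    ∑ t ∈ T n, ell (exchangeRatio F (pathSet t.1 t.2.1 t.2.2 0) t.1 t.2.1 t.2.2) =
      ∑ t ∈ T n, ell (exchangeRatio F (pathSet t.1 t.2.1 t.2.2 n) t.1 t.2.1 t.2.2) := by
  let φ : ℕ → ℕ → ℕ → ℕ → ℝ := fun a b c m => ell (exchangeRatio F (pathSet a b c m) a b c)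
  rw [← sub_eq_zero, ← Finset.sum_sub_distrib]
  have h := sum_T_sum_eq_zero n (fun a b c m => φ a b c (m - 1) - φ a b c m) ?_ ?_
  · rw [← h]
    exact Finset.sum_congr rfl fun t _ =>
      (sum_Icc_telescope (fun m => φ t.1 t.2.1 t.2.2 m) n).symm
  · intro a b c m hab hbc hm
    -- The path set never involves a, b, c themselves, so passing one of them changes nothing.
    have e : pathSet a b c (m - 1) = pathSet a b c m := by
      ext y
      simp only [pathSet, Set.mem_ofPred_eq]
      omega
    simp only [φ, e, sub_self]
  · intro p q r s hp1 hpq hqr hrs hsn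
    -- When a triple in {p, q, r, s} passes the remaining label, its path set changes between this
    -- common B and B with that label added.
    set B : Set ℕ := {y | y < p ∨ (q < y ∧ y < r) ∨ s < y} with hB
    have memB : ∀ y, y ∈ B ↔ y < p ∨ (q < y ∧ y < r) ∨ s < y := fun y => Iff.rfl
    have e1 : pathSet q r s (p - 1) = B := by
      ext y; simp only [pathSet, Set.mem_ofPred_eq, memB]; omega
    have e2 : pathSet q r s p = insert p B := by
      ext y; simp only [pathSet, Set.mem_ofPred_eq, Set.mem_insert_iff, memB]; omega
    have e3 : pathSet p r s (q - 1) = insert q B := by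
      ext y; simp only [pathSet, Set.mem_ofPred_eq, Set.mem_insert_iff, memB]; omega
    have e4 : pathSet p r s q = B := by
      ext y; simp only [pathSet, Set.mem_ofPred_eq, memB]; omega
    have e5 : pathSet p q s (r - 1) = B := by
      ext y; simp only [pathSet, Set.mem_ofPred_eq, memB]; omega
    have e6 : pathSet p q s r = insert r B := by
      ext y; simp only [pathSet, Set.mem_ofPred_eq, Set.mem_insert_iff, memB]; omega
    have e7 : pathSet p q r (s - 1) = insert s B := by
      ext y; simp only [pathSet, Set.mem_ofPred_eq, Set.mem_insert_iff, memB]; omega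
    have e8 : pathSet p q r s = B := by
      ext y; simp only [pathSet, Set.mem_ofPred_eq, memB]; omega
    simp only [φ, e1, e2, e3, e4, e5, e6, e7, e8]
    have := ell_tetrahedron hpos hF hp1 hpq hqr hrs hsn (B := B)
      (by rw [memB]; omega) (by rw [memB]; omega) (by rw [memB]; omega) (by rw [memB]; omega)
    linarith

end TotPosDilog

/-! ### Plücker relations for determinants and flag minors. -/

namespace TotPosDilog

open Matrix

/-- Expanding along the inserted row on both sides gives the same cofactors up to the sign of the
position. -/
theorem det_insertNth {m : ℕ} (p : Fin (m + 1)) (r : Fin (m + 1) → ℝ)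
    (v : Fin m → Fin (m + 1) → ℝ) :
    (Matrix.of (p.insertNth (α := fun _ => Fin (m + 1) → ℝ) r v)).det =
      (-1) ^ (p : ℕ) * (Matrix.of (Fin.cons (α := fun _ => Fin (m + 1) → ℝ) r v)).det := by
  rw [Matrix.det_succ_row _ p, Matrix.det_succ_row_zero, Finset.mul_sum]
  refine Finset.sum_congr rfl fun j _ => ?_
  have e : (Matrix.of (p.insertNth (α := fun _ => Fin (m + 1) → ℝ) r v)).submatrix
      p.succAbove j.succAbove =
      (Matrix.of (Fin.cons (α := fun _ => Fin (m + 1) → ℝ) r v)).submatrix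
        Fin.succ j.succAbove := by
    ext x y
    simp
  rw [e]
  simp [pow_add]
  ring

theorem det_cons_insertNth {m : ℕ} (p : Fin (m + 1)) (r₀ r : Fin (m + 2) → ℝ)
    (v : Fin m → Fin (m + 2) → ℝ) :
    (Matrix.of (Fin.cons (α := fun _ => Fin (m + 2) → ℝ) r₀
      (p.insertNth (α := fun _ => Fin (m + 2) → ℝ) r v))).det =
      (-1) ^ (p : ℕ) * (Matrix.of (Fin.cons (α := fun _ => Fin (m + 2) → ℝ) r₀
        (Fin.cons (α := fun _ => Fin (m + 2) → ℝ) r v))).det := by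
  rw [Matrix.det_succ_row_zero, Matrix.det_succ_row_zero, Finset.mul_sum]
  refine Finset.sum_congr rfl fun j _ => ?_
  have h := det_insertNth p (r ∘ j.succAbove) (fun i => v i ∘ j.succAbove)
  have e1 : (Matrix.of (Fin.cons (α := fun _ => Fin (m + 2) → ℝ) r₀
      (p.insertNth (α := fun _ => Fin (m + 2) → ℝ) r v))).submatrix Fin.succ j.succAbove =
      Matrix.of (p.insertNth (α := fun _ => Fin (m + 1) → ℝ) (r ∘ j.succAbove)
        (fun i => v i ∘ j.succAbove)) := by
    ext x y
    rcases Fin.eq_self_or_eq_succAbove p x with rfl | ⟨z, rfl⟩ <;> simp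
  have e2 : (Matrix.of (Fin.cons (α := fun _ => Fin (m + 2) → ℝ) r₀
      (Fin.cons (α := fun _ => Fin (m + 2) → ℝ) r v))).submatrix Fin.succ j.succAbove =
      Matrix.of (Fin.cons (α := fun _ => Fin (m + 1) → ℝ) (r ∘ j.succAbove)
        (fun i => v i ∘ j.succAbove)) := by
    ext x y
    refine Fin.cases ?_ (fun z => ?_) x <;> simp
  rw [e1, e2, h]
  simp
  ring

/-- The determinant with rows `x`, `y` and then the rows of `A`. -/
noncomputable def consDet {m : ℕ} (A : Fin m → Fin (m + 2) → ℝ) (x y : Fin (m + 2) → ℝ) : ℝ :=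
  (Matrix.of (Fin.cons (α := fun _ => Fin (m + 2) → ℝ) x
    (Fin.cons (α := fun _ => Fin (m + 2) → ℝ) y A))).det

theorem consDet_swap {m : ℕ} (A : Fin m → Fin (m + 2) → ℝ) (x y : Fin (m + 2) → ℝ) :
    consDet A y x = -consDet A x y := by
  have h := det_insertNth (m := m + 1) 1 y (Fin.cons (α := fun _ => Fin (m + 2) → ℝ) x A)
  have e : (1 : Fin (m + 2)).insertNth (α := fun _ => Fin (m + 2) → ℝ) y
      (Fin.cons (α := fun _ => Fin (m + 2) → ℝ) x A) =
      Fin.cons (α := fun _ => Fin (m + 2) → ℝ) x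
        (Fin.cons (α := fun _ => Fin (m + 2) → ℝ) y A) := by
    rw [← Fin.succ_zero_eq_one, Fin.insertNth_succ_cons, Fin.insertNth_zero']
  rw [e] at h
  simp only [consDet]
  rw [h]
  simp

/-- `y ↦ consDet A x y` as a linear map. -/
noncomputable def consDetLin {m : ℕ} (A : Fin m → Fin (m + 2) → ℝ) (x : Fin (m + 2) → ℝ) :
    (Fin (m + 2) → ℝ) →ₗ[ℝ] ℝ :=
  (Matrix.detRowAlternating (R := ℝ) (n := Fin (m + 2))).toMultilinearMap.toLinearMap
    (Fin.cons (α := fun _ => Fin (m + 2) → ℝ) x (Fin.cons (α := fun _ => Fin (m + 2) → ℝ) 0 A)) 1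

theorem update_one_cons {m : ℕ} (A : Fin m → Fin (m + 2) → ℝ) (x y z : Fin (m + 2) → ℝ) :
    Function.update (Fin.cons (α := fun _ => Fin (m + 2) → ℝ) x
      (Fin.cons (α := fun _ => Fin (m + 2) → ℝ) z A)) 1 y =
      Fin.cons (α := fun _ => Fin (m + 2) → ℝ) x
        (Fin.cons (α := fun _ => Fin (m + 2) → ℝ) y A) := by
  rw [← Fin.succ_zero_eq_one, ← Fin.cons_update, Fin.update_cons_zero]

theorem consDetLin_apply {m : ℕ} (A : Fin m → Fin (m + 2) → ℝ) (x y : Fin (m + 2) → ℝ) :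
    consDetLin A x y = consDet A x y := by
  simp only [consDetLin, MultilinearMap.toLinearMap_apply, consDet]
  rw [update_one_cons]
  rfl

theorem consDet_row {m : ℕ} (A : Fin m → Fin (m + 2) → ℝ) (x : Fin (m + 2) → ℝ) (i : Fin m) :
    consDet A x (A i) = 0 := by
  refine Matrix.det_zero_of_row_eq (i := 1) (j := i.succ.succ) ?_ ?_
  · rw [← Fin.succ_zero_eq_one]; simp [Fin.ext_iff]
  · rfl

/-- The three-term Grassmann–Plücker relation. -/
theorem consDet_threeTerm {m : ℕ} (A : Fin m → Fin (m + 2) → ℝ) (x a b c : Fin (m + 2) → ℝ) :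
    consDet A x b * consDet A a c =
      consDet A x a * consDet A b c + consDet A x c * consDet A a b := by
  set M : Matrix (Fin (m + 2)) (Fin (m + 2)) ℝ :=
    Matrix.of (Fin.cons (α := fun _ => Fin (m + 2) → ℝ) b
      (Fin.cons (α := fun _ => Fin (m + 2) → ℝ) c A)) with hM
  -- Cramer's rule expands det M · a in the rows b, c, A of M. The linear form `consDetLin A x`
  -- kills the rows of A, leaving the three terms of the relation.
  have h := Matrix.mulVec_cramer Mᵀ a
  rw [Matrix.mulVec_transpose, Matrix.vecMul_eq_sum, Matrix.det_transpose] at h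
  have h2 := congrArg (consDetLin A x) h
  rw [map_sum, map_smul, Fin.sum_univ_succ, Fin.sum_univ_succ] at h2
  have hz : ∀ i : Fin m, consDetLin A x (Mᵀ.cramer a i.succ.succ • M i.succ.succ) = 0 := by
    intro i
    rw [map_smul, consDetLin_apply]
    have : M i.succ.succ = A i := rfl
    rw [this, consDet_row, smul_zero]
  rw [Finset.sum_eq_zero (fun i _ => hz i)] at h2
  simp only [add_zero, map_smul, consDetLin_apply, smul_eq_mul,
    Matrix.cramer_transpose_apply] at h2
  have m0 : M 0 = b := rfl
  have m1 : M (Fin.succ 0) = c := rfl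
  have u0 : (M.updateRow 0 a).det = consDet A a c := by
    simp only [consDet, hM]
    congr 1
    exact Fin.update_cons_zero (α := fun _ => Fin (m + 2) → ℝ) _ _ _
  have u1 : (M.updateRow (Fin.succ 0) a).det = consDet A b a := by
    simp only [consDet, hM]
    congr 1
    exact update_one_cons A b a c
  have md : M.det = consDet A b c := rfl
  rw [m0, m1, u0, u1, md, consDet_swap A a b] at h2
  linarith

/-- The flag minor with rows `φ 0, φ 1, …` and columns in `J`. -/
noncomputable def flagMinor {α : Type*} [LinearOrder α] (φ : ℕ → α → ℝ) (J : Finset α) : ℝ :=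
  (Matrix.of fun i j : Fin J.card => φ i (J.orderEmbOfFin rfl j)).det

section

variable {α : Type*} [LinearOrder α]

theorem flagMinor_eq_det (φ : ℕ → α → ℝ) {J : Finset α} {k : ℕ} (f : Fin k → α)
    (hf : StrictMono f) (hJ : ∀ x, x ∈ J ↔ ∃ i, f i = x) :
    flagMinor φ J = (Matrix.of fun i j : Fin k => φ i (f j)).det := by
  have hcard : J.card = k := by
    have : J = Finset.univ.image f := by ext x; simp [hJ]
    rw [this, Finset.card_image_of_injective _ hf.injective]; simp
  subst hcard
  have : f = J.orderEmbOfFin rfl :=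
    Finset.orderEmbOfFin_unique rfl (fun i => (hJ _).2 ⟨i, rfl⟩) hf
  rw [this]
  rfl

theorem exists_orderEmbOfFin_insert {J : Finset α} {m : ℕ} (hm : J.card = m) {a : α}
    (hm' : (insert a J).card = m + 1) :
    ∃ p : Fin (m + 1), (p : ℕ) = (J.filter (· < a)).card ∧
      ⇑((insert a J).orderEmbOfFin hm') =
        p.insertNth (α := fun _ => α) a (J.orderEmbOfFin hm) := by
  set e := (insert a J).orderEmbOfFin hm' with he
  have hr : ∀ x, x ∈ insert a J ↔ ∃ i, e i = x := by
    intro x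
    rw [← Finset.mem_coe, ← Finset.range_orderEmbOfFin _ hm', Set.mem_range]
  obtain ⟨p, hp⟩ := (hr a).1 (Finset.mem_insert_self a J)
  have hs : (fun i => e (p.succAbove i)) = J.orderEmbOfFin hm := by
    refine Finset.orderEmbOfFin_unique hm (fun i => ?_)
      (e.strictMono.comp (Fin.strictMono_succAbove p))
    have h := (hr (e (p.succAbove i))).2 ⟨_, rfl⟩
    rw [Finset.mem_insert, ← hp] at h
    exact h.resolve_left fun h => Fin.succAbove_ne p i (e.injective h)
  refine ⟨p, ?_, ?_⟩
  · have : J.filter (· < a) = (Finset.Iio p).map e.toEmbedding := by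
      ext x
      simp only [Finset.mem_filter, Finset.mem_map, Finset.mem_Iio, RelEmbedding.coe_toEmbedding]
      constructor
      · rintro ⟨hx, hxa⟩
        obtain ⟨i, rfl⟩ := (hr x).1 (Finset.mem_insert_of_mem hx)
        exact ⟨i, by rwa [← hp, e.lt_iff_lt] at hxa, rfl⟩
      · rintro ⟨i, hi, rfl⟩
        have hlt : e i < a := by rw [← hp]; exact e.strictMono hi
        refine ⟨?_, hlt⟩
        exact (Finset.mem_insert.1 ((hr _).2 ⟨i, rfl⟩)).resolve_left hlt.ne
    rw [this, Finset.card_map]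
    simp
  · rw [← hs]
    symm
    rw [Fin.insertNth_eq_iff]
    exact ⟨hp.symm, rfl⟩

theorem flagMinor_eq_det_rows (φ : ℕ → α → ℝ) {J : Finset α} {k : ℕ} (h : J.card = k) :
    flagMinor φ J = (Matrix.of fun i j : Fin k => φ j (J.orderEmbOfFin h i)).det := by
  subst h
  rw [flagMinor, ← Matrix.det_transpose]
  rfl

/-- The first `k` values of the functions `φ` at the element `x`. -/
def flagRow (φ : ℕ → α → ℝ) (k : ℕ) (x : α) : Fin k → ℝ := fun j => φ j x

/-- The number of elements of J below a is the position at which a enters the ordered set, hence the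
sign. -/
theorem flagMinor_insert (φ : ℕ → α → ℝ) {J : Finset α} {m : ℕ} (h : J.card = m) {a : α}
    (ha : a ∉ J) :
    flagMinor φ (insert a J) = (-1) ^ (J.filter (· < a)).card *
      (Matrix.of (Fin.cons (α := fun _ => Fin (m + 1) → ℝ) (flagRow φ (m + 1) a)
        fun i => flagRow φ (m + 1) (J.orderEmbOfFin h i))).det := by
  have h' : (insert a J).card = m + 1 := by rw [Finset.card_insert_of_notMem ha, h]
  obtain ⟨p, hp, hi⟩ := exists_orderEmbOfFin_insert h h'
  rw [flagMinor_eq_det_rows φ h', ← hp, ← det_insertNth, hi]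
  congr 1
  ext i j
  rcases Fin.eq_self_or_eq_succAbove p i with rfl | ⟨z, rfl⟩ <;> simp [flagRow]

theorem flagMinor_insert_insert (φ : ℕ → α → ℝ) {J : Finset α} {m : ℕ} (h : J.card = m)
    {a b : α} (ha : a ∉ J) (hb : b ∉ J) (hab : a < b) :
    flagMinor φ (insert a (insert b J)) =
      (-1) ^ (J.filter (· < a)).card * (-1) ^ (J.filter (· < b)).card *
        consDet (fun i => flagRow φ (m + 2) (J.orderEmbOfFin h i)) (flagRow φ (m + 2) a)
          (flagRow φ (m + 2) b) := by
  have h' : (insert b J).card = m + 1 := by rw [Finset.card_insert_of_notMem hb, h]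
  obtain ⟨p, hp, hi⟩ := exists_orderEmbOfFin_insert h h'
  have hf : (insert b J).filter (· < a) = J.filter (· < a) := by
    rw [Finset.filter_insert, if_neg hab.not_gt]
  have ha' : a ∉ insert b J := by simp [ha, hab.ne]
  rw [flagMinor_insert φ h' ha', hf, mul_assoc, ← hp, consDet, ← det_cons_insertNth, hi]
  congr 3
  congr 1
  ext i j
  rcases Fin.eq_self_or_eq_succAbove p i with rfl | ⟨z, rfl⟩ <;> simp [flagRow]

/-- The three-term relation between the flag minors of `φ` and those of the sequence `ψ`
obtained from `φ` by omitting the term with index `p`. -/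
theorem flagMinor_threeTerm {φ ψ : ℕ → α → ℝ} {S : Finset α} {m : ℕ} (hm : S.card = m)
    (p : Fin (m + 2)) (hψ : ∀ (t : Fin (m + 1)) x, ψ t x = φ (p.succAbove t) x) {a b c : α}
    (hab : a < b) (hbc : b < c) (ha : a ∉ S) (hb : b ∉ S) (hc : c ∉ S) :
    flagMinor ψ (insert b S) * flagMinor φ (insert a (insert c S)) =
      flagMinor ψ (insert a S) * flagMinor φ (insert b (insert c S)) +
        flagMinor ψ (insert c S) * flagMinor φ (insert a (insert b S)) := by
  set A := fun i => flagRow φ (m + 2) (S.orderEmbOfFin hm i) with hA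
  -- A first row equal to the unit vector e_p deletes column p, so minors of ψ become determinants
  -- of the same size as those of φ, and the claim is `consDet_threeTerm` with x = e_p.
  have key : ∀ x : α, x ∉ S → flagMinor ψ (insert x S) = (-1) ^ (S.filter (· < x)).card *
      ((-1) ^ (p : ℕ) * consDet A (Pi.single p 1) (flagRow φ (m + 2) x)) := by
    intro x hx
    rw [flagMinor_insert ψ hm hx]
    congr 1
    rw [consDet, Matrix.det_succ_row_zero (Matrix.of (Fin.cons (Pi.single p 1) _)),
      Finset.sum_eq_single p]
    · have e : ∀ z : ℝ, (-1 : ℝ) ^ (p : ℕ) * ((-1) ^ (p : ℕ) * 1 * z) = z := by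
        intro z
        rw [mul_one, ← mul_assoc, ← pow_add, Even.neg_one_pow ⟨_, rfl⟩, one_mul]
      simp only [Matrix.of_apply, Fin.cons_zero, Pi.single_eq_same]
      rw [e]
      congr 1
      ext i j
      refine Fin.cases ?_ (fun z => ?_) i <;> simp [flagRow, hψ, hA]
    · intro j _ hj
      simp [hj]
    · simp
  rw [key a ha, key b hb, key c hc, flagMinor_insert_insert φ hm ha hc (hab.trans hbc),
    flagMinor_insert_insert φ hm hb hc hbc, flagMinor_insert_insert φ hm ha hb hab]
  have h := consDet_threeTerm A (Pi.single p 1) (flagRow φ (m + 2) a) (flagRow φ (m + 2) b)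
    (flagRow φ (m + 2) c)
  linear_combination ((-1) ^ (S.filter (· < a)).card * (-1) ^ (S.filter (· < b)).card *
    (-1) ^ (S.filter (· < c)).card * (-1) ^ (p : ℕ)) * h

end

end TotPosDilog

/-! ### Flag minors of triangular matrices and the ratios Y. -/

namespace TotPosDilog

open Matrix

/-- The rows of a matrix, continued by zero. -/
noncomputable def rowFn {n : ℕ} (G : Matrix (Fin n) (Fin n) ℝ) (t : ℕ) (x : Fin n) : ℝ :=
  if h : t < n then G ⟨t, h⟩ x else 0

/-- The entries of a matrix, continued by zero. -/
noncomputable def entry {n : ℕ} (G : Matrix (Fin n) (Fin n) ℝ) (i j : ℕ) : ℝ :=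
  if h : i < n ∧ j < n then G ⟨i, h.1⟩ ⟨j, h.2⟩ else 0

/-- The reflection in the antidiagonal. -/
def anti {n : ℕ} (G : Matrix (Fin n) (Fin n) ℝ) : Matrix (Fin n) (Fin n) ℝ :=
  Matrix.of fun i j => G j.rev i.rev

/-- The set of indices whose one-based labels lie in `P`. -/
noncomputable def idxSet (n : ℕ) (P : Set ℕ) : Finset (Fin n) :=
  open Classical in Finset.univ.filter fun i : Fin n => (i : ℕ) + 1 ∈ P

/-- The `k × k` minor of consecutive rows and columns starting at `(r, c)`. -/
noncomputable def solidMinor {n : ℕ} (G : Matrix (Fin n) (Fin n) ℝ) (r c k : ℕ) : ℝ :=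
  (Matrix.of fun i j : Fin k => entry G (r + i) (c + j)).det

variable {n : ℕ}

theorem rowFn_fin (G : Matrix (Fin n) (Fin n) ℝ) (i j : Fin n) : rowFn G i j = G i j := by
  simp [rowFn]

theorem anti_anti (G : Matrix (Fin n) (Fin n) ℝ) : anti (anti G) = G := by
  ext i j; simp [anti]

theorem mem_bar {I : Finset (Fin n)} {x : Fin n} : x ∈ bar I ↔ x.rev ∈ I := by
  simp only [bar, Finset.mem_image]
  constructor
  · rintro ⟨y, hy, rfl⟩; simpa
  · intro h; exact ⟨_, h, by simp⟩

theorem bar_bar (I : Finset (Fin n)) : bar (bar I) = I := by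
  ext x; simp [mem_bar]

theorem mem_idxSet {P : Set ℕ} {x : Fin n} : x ∈ idxSet n P ↔ (x : ℕ) + 1 ∈ P := by
  simp [idxSet]

theorem mem_seg {a b : ℕ} {x : Fin n} : x ∈ seg n a b ↔ a ≤ (x : ℕ) + 1 ∧ (x : ℕ) + 1 ≤ b := by
  simp [seg]

theorem idxSet_insert {P : Set ℕ} {a : ℕ} (ha : 1 ≤ a) (han : a ≤ n) :
    idxSet n (insert a P) = insert (⟨a - 1, by omega⟩ : Fin n) (idxSet n P) := by
  ext x
  simp only [mem_idxSet, Finset.mem_insert, Set.mem_insert_iff, Fin.ext_iff]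
  have : (x : ℕ) + 1 = a ↔ (x : ℕ) = a - 1 := by omega
  rw [this]

theorem upperMinor_eq_flagMinor (G : Matrix (Fin n) (Fin n) ℝ) (J : Finset (Fin n)) :
    upperMinor G J = flagMinor (rowFn G) J := by
  unfold upperMinor flagMinor
  congr 1
  ext i j
  have : (i : ℕ) < n := by have := J.card_le_univ; have := i.2; simp at *; omega
  simp [rowFn, this]

/-- The antidiagonal reflection turns last columns into first rows. Both orders are reversed, so the
signs cancel. -/
theorem rightMinor_eq_upperMinor (G : Matrix (Fin n) (Fin n) ℝ) (I : Finset (Fin n)) :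
    rightMinor G I = upperMinor (anti G) (bar I) := by
  have hc : I.card ≤ n := by simpa using I.card_le_univ
  rw [upperMinor_eq_flagMinor,
    flagMinor_eq_det _ (k := I.card) (fun i => (I.orderEmbOfFin rfl i.rev).rev)]
  · rw [rightMinor, ← Matrix.det_transpose, ← Matrix.det_submatrix_equiv_self Fin.revPerm]
    congr 1
    ext i j
    have hi : (i : ℕ) < n := by omega
    simp only [Matrix.submatrix_apply, Matrix.transpose_apply, Matrix.of_apply, Fin.revPerm_apply,
      rowFn, hi, dif_pos, anti, Fin.rev_rev]
    congr 1
    simp only [Fin.ext_iff, Fin.val_rev]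
    omega
  · intro i j hij
    simpa using hij
  · intro x
    rw [mem_bar, ← Finset.mem_coe, ← Finset.range_orderEmbOfFin I rfl, Set.mem_range]
    constructor
    · rintro ⟨i, hi⟩
      exact ⟨i.rev, by simp [hi]⟩
    · rintro ⟨i, hi⟩
      exact ⟨i.rev, by simp [← hi]⟩

theorem threeTerm_upperMinor (G : Matrix (Fin n) (Fin n) ℝ) :
    ThreeTerm n fun P => upperMinor G (idxSet n P) := by
  intro S a b c ha hab hbc hc haS hbS hcS
  simp only [upperMinor_eq_flagMinor]
  have ha' : a ≤ n := by omega
  have hb : 1 ≤ b := by omega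
  have hb' : b ≤ n := by omega
  have hc1 : 1 ≤ c := by omega
  rw [idxSet_insert ha ha', idxSet_insert hb hb', idxSet_insert hc1 hc, idxSet_insert ha ha',
    idxSet_insert hb hb', idxSet_insert ha ha', idxSet_insert hc1 hc, idxSet_insert hb hb']
  -- Omitting the last row leaves the sequence of rows unchanged where the smaller minors read it.
  refine flagMinor_threeTerm (φ := rowFn G) (ψ := rowFn G) rfl (Fin.last _) (by simp)
    ?_ ?_ ?_ ?_ ?_
  · simp only [Fin.mk_lt_mk]; omega
  · simp only [Fin.mk_lt_mk]; omega
  · rw [mem_idxSet]; simpa [Nat.sub_add_cancel ha]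
  · rw [mem_idxSet]; simpa [Nat.sub_add_cancel hb]
  · rw [mem_idxSet]; simpa [Nat.sub_add_cancel hc1]

theorem threeTerm_rightMinor (G : Matrix (Fin n) (Fin n) ℝ) :
    ThreeTerm n fun P => rightMinor G (idxSet n P) := by
  have hbar : ∀ P : Set ℕ, bar (idxSet n P) = idxSet n {y | y ≤ n ∧ n + 1 - y ∈ P} := by
    intro P
    ext x
    have e : n - ((x : ℕ) + 1) + 1 = n + 1 - ((x : ℕ) + 1) := by omega
    have hx : (x : ℕ) + 1 ≤ n := x.2
    rw [mem_bar, mem_idxSet, mem_idxSet, Fin.val_rev, e]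
    exact ⟨fun h => ⟨hx, h⟩, fun h => h.2⟩
  have hins : ∀ (P : Set ℕ) (a : ℕ), 1 ≤ a → a ≤ n →
      {y | y ≤ n ∧ n + 1 - y ∈ insert a P} = insert (n + 1 - a) {y | y ≤ n ∧ n + 1 - y ∈ P} := by
    intro P a ha ha'
    ext y
    simp only [Set.mem_ofPred_eq, Set.mem_insert_iff]
    have : y = n + 1 - a ↔ y ≤ n ∧ n + 1 - y = a := by omega
    rw [this]
    tauto
  intro S a b c ha hab hbc hc haS hbS hcS
  have ha' : a ≤ n := by omega
  have hb : 1 ≤ b := by omega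
  have hb' : b ≤ n := by omega
  have hc1 : 1 ≤ c := by omega
  simp only [rightMinor_eq_upperMinor, hbar]
  rw [hins _ b hb hb', hins _ a ha ha', hins _ a ha ha', hins _ b hb hb', hins _ c hc1 hc,
    hins _ a ha ha', hins _ b hb hb']
  have mem : ∀ x, 1 ≤ x → x ≤ n → x ∉ S → n + 1 - x ∉ {y | y ≤ n ∧ n + 1 - y ∈ S} := by
    intro x hx hx' hxS h
    have e : n + 1 - (n + 1 - x) = x := by omega
    exact hxS (e ▸ h.2)
  -- Reversal swaps the roles of a and c, under which the relation is symmetric.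
  have h := threeTerm_upperMinor (anti G) {y | y ≤ n ∧ n + 1 - y ∈ S} (n + 1 - c) (n + 1 - b)
    (n + 1 - a) (by omega) (by omega) (by omega) (by omega) (mem c hc1 hc hcS) (mem b hb hb' hbS)
    (mem a ha ha' haS)
  simp only at h
  rw [Set.insert_comm (n + 1 - c) (n + 1 - a), Set.insert_comm (n + 1 - b) (n + 1 - a),
    Set.insert_comm (n + 1 - c) (n + 1 - b)] at h
  linarith

section Ratios

variable (G : Matrix (Fin n) (Fin n) ℝ) {a b c : ℕ}

theorem Ylow_eq_exchangeRatio (ha : 1 ≤ a) (hab : a < b) (hbc : b < c) :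
    Ylow G a b c =
      exchangeRatio (fun P => rightMinor G (idxSet n P)) (pathSet a b c 0) a b c := by
  unfold Ylow exchangeRatio
  congr 3 <;> ext x <;> have := x.2 <;>
    simp only [Finset.mem_union, mem_seg, mem_idxSet, Set.mem_insert_iff, pathSet,
      Set.mem_ofPred_eq] <;> omega

theorem Ytlow_eq_exchangeRatio (ha : 1 ≤ a) (hab : a < b) (hbc : b < c) :
    Ytlow G a b c =
      exchangeRatio (fun P => rightMinor G (idxSet n P)) (pathSet a b c n) a b c := by
  unfold Ytlow exchangeRatio
  congr 3 <;> ext x <;> have := x.2 <;>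
    simp only [Finset.mem_union, mem_seg, mem_idxSet, Set.mem_insert_iff, pathSet,
      Set.mem_ofPred_eq] <;> omega

theorem one_div_Yup_eq_exchangeRatio (ha : 1 ≤ a) (hab : a < b) (hbc : b < c) :
    1 / Yup G a b c =
      exchangeRatio (fun P => upperMinor G (idxSet n P)) (pathSet a b c 0) a b c := by
  unfold Yup exchangeRatio
  rw [one_div_div]
  congr 3 <;> ext x <;> have := x.2 <;>
    simp only [Finset.mem_union, mem_seg, mem_idxSet, Set.mem_insert_iff, pathSet,
      Set.mem_ofPred_eq] <;> omega

theorem one_div_Ytup_eq_exchangeRatio (ha : 1 ≤ a) (hab : a < b) (hbc : b < c) :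
    1 / Ytup G a b c =
      exchangeRatio (fun P => upperMinor G (idxSet n P)) (pathSet a b c n) a b c := by
  unfold Ytup exchangeRatio
  rw [one_div_div]
  congr 3 <;> ext x <;> have := x.2 <;>
    simp only [Finset.mem_union, mem_seg, mem_idxSet, Set.mem_insert_iff, pathSet,
      Set.mem_ofPred_eq] <;> omega

end Ratios

theorem flagMinor_insert_min {α : Type*} [LinearOrder α] (φ : ℕ → α → ℝ) {J : Finset α} {m : α}
    (hm : ∀ x ∈ J, m < x) (hφ : ∀ t, φ (t + 1) m = 0) :
    flagMinor φ (insert m J) = φ 0 m * flagMinor (fun t => φ (t + 1)) J := by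
  have hmJ : m ∉ J := fun h => (hm m h).false
  have hf : J.filter (· < m) = ∅ :=
    Finset.filter_eq_empty_iff.2 fun x hx => (hm x hx).not_gt
  rw [flagMinor_insert φ rfl hmJ, hf, flagMinor_eq_det_rows _ rfl, Matrix.det_succ_row_zero,
    Fin.sum_univ_succ, Finset.sum_eq_zero]
  · simp only [Finset.card_empty, pow_zero, one_mul, add_zero, Fin.val_zero, Matrix.of_apply,
      Fin.cons_zero, flagRow]
    congr 2
  · intro j _
    simp [flagRow, hφ]

/-- The first a columns vanish below the diagonal, so their diagonal entries split off one by one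
and the remaining minor starts at row a (zero-based). -/
theorem upperMinor_seg_union {G : Matrix (Fin n) (Fin n) ℝ} (hG : ∀ i j : Fin n, j < i → G i j = 0)
    (a : ℕ) (han : a ≤ n) (J : Finset (Fin n)) (hJ : ∀ x ∈ J, a ≤ (x : ℕ)) :
    upperMinor G (seg n 1 a ∪ J) =
      (∏ i ∈ Finset.range a, entry G i i) * flagMinor (fun t => rowFn G (a + t)) J := by
  induction a generalizing J with
  | zero =>
    have : seg n 1 0 ∪ J = J := by
      ext x; simp only [Finset.mem_union, mem_seg]; constructor
      · rintro (h | h)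
        · omega
        · exact h
      · exact Or.inr
    rw [this, upperMinor_eq_flagMinor]
    simp
  | succ a ih =>
    have e : seg n 1 (a + 1) ∪ J = seg n 1 a ∪ insert (⟨a, by omega⟩ : Fin n) J := by
      ext x
      simp only [Finset.mem_union, mem_seg, Finset.mem_insert, Fin.ext_iff]
      have : 1 ≤ (x : ℕ) + 1 ∧ (x : ℕ) + 1 ≤ a + 1 ↔
        (1 ≤ (x : ℕ) + 1 ∧ (x : ℕ) + 1 ≤ a) ∨ (x : ℕ) = a := by omega
      rw [this]; tauto
    rw [e, ih (by omega), flagMinor_insert_min, Finset.prod_range_succ, mul_assoc]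
    · congr 2
      · simp [rowFn, entry]
      · refine congrArg (fun φ => flagMinor φ J) (funext fun t => ?_)
        congr 1; omega
    · intro x hx
      have := hJ x hx
      rw [Fin.lt_def]
      simpa using this
    · intro t
      simp only [rowFn]
      split_ifs with h
      · exact hG _ _ (by rw [Fin.lt_def]; simp)
      · rfl
    · intro x hx
      rcases Finset.mem_insert.1 hx with rfl | hx
      · simp
      · have := hJ x hx; omega

theorem flagMinor_seg (G : Matrix (Fin n) (Fin n) ℝ) {a b c : ℕ} (hb : 1 ≤ b) (hc : c ≤ n) :
    flagMinor (fun t => rowFn G (a + t)) (seg n b c) = solidMinor G a (b - 1) (c + 1 - b) := by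
  rw [flagMinor_eq_det _ (k := c + 1 - b) (fun i => (⟨b - 1 + i, by omega⟩ : Fin n))]
  · rw [solidMinor]
    congr 1
    ext i j
    have : b - 1 + (j : ℕ) < n := by omega
    simp [rowFn, entry, this]
  · intro i j hij
    simpa using hij
  · intro x
    rw [mem_seg]
    constructor
    · intro h
      exact ⟨⟨(x : ℕ) + 1 - b, by omega⟩, by simp only [Fin.ext_iff]; omega⟩
    · rintro ⟨i, rfl⟩
      simp only
      omega

theorem upperMinor_seg_union_seg {G : Matrix (Fin n) (Fin n) ℝ}
    (hG : ∀ i j : Fin n, j < i → G i j = 0) {a b c : ℕ} (hab : a < b) (han : a ≤ n)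
    (hc : c ≤ n) :
    upperMinor G (seg n 1 a ∪ seg n b c) =
      (∏ i ∈ Finset.range a, entry G i i) * solidMinor G a (b - 1) (c + 1 - b) := by
  rw [upperMinor_seg_union hG a han, flagMinor_seg G (by omega) hc]
  intro x hx
  rw [mem_seg] at hx
  omega

theorem anti_upper {G : Matrix (Fin n) (Fin n) ℝ} (hG : ∀ i j : Fin n, j < i → G i j = 0)
    (i j : Fin n) (hij : j < i) : anti G i j = 0 :=
  hG _ _ (by simpa using hij)

theorem solidMinor_anti (G : Matrix (Fin n) (Fin n) ℝ) {r c k : ℕ} (hr : r + k ≤ n)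
    (hc : c + k ≤ n) : solidMinor (anti G) r c k = solidMinor G (n - c - k) (n - r - k) k := by
  rw [solidMinor, ← Matrix.det_transpose, ← Matrix.det_submatrix_equiv_self Fin.revPerm]
  rw [solidMinor]
  congr 1
  ext i j
  have h1 : r + (k - ((j : ℕ) + 1)) < n := by omega
  have h2 : c + (k - ((i : ℕ) + 1)) < n := by omega
  have h3 : n - c - k + (i : ℕ) < n := by omega
  have h4 : n - r - k + (j : ℕ) < n := by omega
  simp only [Matrix.submatrix_apply, Matrix.transpose_apply, Matrix.of_apply, Fin.revPerm_apply,
    entry, Fin.val_rev, h1, h2, h3, h4, and_self, dif_pos, anti]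
  congr 1 <;> simp only [Fin.ext_iff, Fin.val_rev] <;> omega

theorem rightMinor_seg_union_seg {G : Matrix (Fin n) (Fin n) ℝ}
    (hG : ∀ i j : Fin n, j < i → G i j = 0) {a b c : ℕ} (ha : 1 ≤ a) (hab : a ≤ b + 1)
    (hbc : b < c) (hc : c ≤ n + 1) :
    rightMinor G (seg n a b ∪ seg n c n) =
      (∏ i ∈ Finset.range (n + 1 - c), entry (anti G) i i) *
        solidMinor G (a - 1) (c + a - b - 2) (b + 1 - a) := by
  have e : bar (seg n a b ∪ seg n c n) =
      seg n 1 (n + 1 - c) ∪ seg n (n + 1 - b) (n + 1 - a) := by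
    ext x
    simp only [mem_bar, Finset.mem_union, mem_seg, Fin.val_rev]
    omega
  rw [rightMinor_eq_upperMinor, e, upperMinor_seg_union_seg (anti_upper hG) (by omega) (by omega)
    (by omega), solidMinor_anti G (by omega) (by omega)]
  congr 2 <;> omega

end TotPosDilog

/-! ### Positivity of flag minors and equalities between the dilogarithm sums. -/

namespace TotPosDilog

open Matrix

variable {n : ℕ}

theorem det_of_upper {k : ℕ} {M : Matrix (Fin k) (Fin k) ℝ} (h : ∀ i j, j < i → M i j = 0) :
    M.det = ∏ i, M i i :=
  Matrix.det_of_isUpperTriangular fun i j hij => h i j hij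

theorem det_of_lower {k : ℕ} {M : Matrix (Fin k) (Fin k) ℝ} (h : ∀ i j, i < j → M i j = 0) :
    M.det = ∏ i, M i i := by
  rw [← Matrix.det_transpose, det_of_upper (M := Mᵀ) fun i j hij => h j i hij]
  rfl

/-- A minor with rows `r` and columns `c` does not vanish identically on `B n` if `r ≤ c`. -/
theorem exists_mem_B_det_ne_zero {k : ℕ} (r c : Fin k ↪o Fin n) (h : ∀ i, r i ≤ c i) :
    ∃ H ∈ B n, (H.submatrix r c).det ≠ 0 := by
  classical
  -- Ones on the diagonal and at the places (r t, c t): the matrix is upper unitriangular, and the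
  -- chosen submatrix is lower unitriangular because r i ≤ c i < c j for i < j.
  refine ⟨Matrix.of fun i j => if i = j ∨ ∃ t, r t = i ∧ c t = j then 1 else 0, ⟨?_, ?_⟩, ?_⟩
  · intro i j hij
    rw [Matrix.of_apply, if_neg]
    rintro (rfl | ⟨t, rfl, rfl⟩)
    · exact hij.false
    · exact (h t).not_gt hij
  · rw [Matrix.isUnit_iff_isUnit_det, det_of_upper]
    · simp
    · intro i j hij
      rw [Matrix.of_apply, if_neg]
      rintro (rfl | ⟨t, rfl, rfl⟩)
      · exact hij.false
      · exact (h t).not_gt hij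
  · rw [det_of_lower]
    · simp
    · intro i j hij
      rw [Matrix.submatrix_apply, Matrix.of_apply, if_neg]
      rintro (h' | ⟨t, ht, ht'⟩)
      · exact absurd ((h i).trans_lt (c.strictMono hij)) (by rw [h']; exact lt_irrefl _)
      · rw [r.injective ht, c.injective.eq_iff] at ht'
        exact hij.ne ht'

theorem det_submatrix_anti {k : ℕ} (G : Matrix (Fin n) (Fin n) ℝ) (r c : Fin k → Fin n) :
    ((anti G).submatrix r c).det =
      (G.submatrix (fun i : Fin k => (c i.rev).rev) fun i : Fin k => (r i.rev).rev).det := by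
  rw [← Matrix.det_transpose, ← Matrix.det_submatrix_equiv_self Fin.revPerm]
  rfl

theorem anti_mem_B {G : Matrix (Fin n) (Fin n) ℝ} (hG : G ∈ B n) : anti G ∈ B n := by
  refine ⟨anti_upper hG.1, ?_⟩
  have h := hG.2
  rw [Matrix.isUnit_iff_isUnit_det] at h ⊢
  have e := det_submatrix_anti G id id
  simp only [Matrix.submatrix_id_id, id] at e
  rw [e]
  have e' : (G.submatrix (fun i => i.rev.rev) fun i => i.rev.rev) = G := by ext; simp
  rwa [e']

/-- An order embedding of `Fin k` into `Fin n` conjugated by the order reversals. -/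
def revEmb {k : ℕ} (r : Fin k ↪o Fin n) : Fin k ↪o Fin n :=
  OrderEmbedding.ofStrictMono (fun i => (r i.rev).rev) fun i j hij => by simpa using hij

theorem anti_mem_BPlus {G : Matrix (Fin n) (Fin n) ℝ} (hG : G ∈ BPlus n) : anti G ∈ BPlus n := by
  refine ⟨anti_mem_B hG.1, fun k r c => ?_⟩
  rintro ⟨H, hH, hdet⟩
  have key : ∀ M : Matrix (Fin n) (Fin n) ℝ, ((anti M).submatrix r c).det =
      (M.submatrix (revEmb c) (revEmb r)).det := fun M => det_submatrix_anti M r c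
  rw [key]
  refine hG.2 k _ _ ⟨anti H, anti_mem_B hH, ?_⟩
  rwa [← key, anti_anti]

theorem upperMinor_pos {G : Matrix (Fin n) (Fin n) ℝ} (hG : G ∈ BPlus n) (J : Finset (Fin n)) :
    0 < upperMinor G J := by
  have hc : J.card ≤ n := by simpa using J.card_le_univ
  refine hG.2 _ (Fin.castLEOrderEmb hc) (J.orderEmbOfFin rfl) (exists_mem_B_det_ne_zero _ _ ?_)
  have h : ∀ (m : ℕ) (hm : m < J.card), m ≤ (J.orderEmbOfFin rfl ⟨m, hm⟩ : ℕ) := by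
    intro m
    induction m with
    | zero => intro _; exact Nat.zero_le _
    | succ m ih =>
      intro hm
      have h1 := ih (by omega)
      have h2 : J.orderEmbOfFin rfl ⟨m, by omega⟩ < J.orderEmbOfFin rfl ⟨m + 1, hm⟩ :=
        (J.orderEmbOfFin rfl).strictMono (by simp)
      rw [Fin.lt_def] at h2
      omega
  intro i
  rw [Fin.le_def]
  exact h i i.2

theorem rightMinor_pos {G : Matrix (Fin n) (Fin n) ℝ} (hG : G ∈ BPlus n) (I : Finset (Fin n)) :
    0 < rightMinor G I := by
  rw [rightMinor_eq_upperMinor]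
  exact upperMinor_pos (anti_mem_BPlus hG) _

theorem mem_T {t : ℕ × ℕ × ℕ} : t ∈ T n ↔ 1 ≤ t.1 ∧ t.1 < t.2.1 ∧ t.2.1 < t.2.2 ∧ t.2.2 ≤ n := by
  simp only [T, Finset.mem_filter, Finset.mem_product, Finset.mem_Icc]
  omega

theorem dilogSum_congr {Z W : ℕ → ℕ → ℕ → ℝ}
    (h : ∀ a b c, 1 ≤ a → a < b → b < c → c ≤ n → Z a b c = W a b c) :
    dilogSum n Z = dilogSum n W :=
  sum_T_congr (f := fun a b c => ell (Z a b c)) (g := fun a b c => ell (W a b c))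
    fun a b c h1 h2 h3 h4 => by rw [h a b c h1 h2 h3 h4]

theorem dilogSumInv_eq (Z : ℕ → ℕ → ℕ → ℝ) :
    dilogSumInv n Z = dilogSum n fun a b c => 1 / Z a b c := rfl

/-- The value of C is irrelevant: it only serves to pass between equalities of sums and equalities
of inverse sums over the same triples. -/
theorem exists_dilogSum_reflection (n : ℕ) : ∃ C : ℝ, ∀ Z : ℕ → ℕ → ℕ → ℝ,
    (∀ a b c, 0 < Z a b c) → dilogSum n Z + dilogSumInv n Z = C := by
  obtain ⟨C, hC⟩ := exists_ell_reflection
  refine ⟨(T n).card * C, fun Z hZ => ?_⟩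
  rw [dilogSum, dilogSumInv, ← Finset.sum_add_distrib,
    Finset.sum_congr rfl fun t _ => hC _ (hZ _ _ _)]
  simp

theorem dilogSum_reverse (Z : ℕ → ℕ → ℕ → ℝ) :
    dilogSum n (fun a b c => Z (n + 1 - c) (n + 1 - b) (n + 1 - a)) = dilogSum n Z := by
  refine Finset.sum_nbij' (fun t => (n + 1 - t.2.2, n + 1 - t.2.1, n + 1 - t.1))
    (fun t => (n + 1 - t.2.2, n + 1 - t.2.1, n + 1 - t.1)) ?_ ?_ ?_ ?_ ?_
  · intro t ht; rw [mem_T] at ht ⊢; simp only; omega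
  · intro t ht; rw [mem_T] at ht ⊢; simp only; omega
  · intro t ht; rw [mem_T] at ht; ext <;> simp only <;> omega
  · intro t ht; rw [mem_T] at ht; ext <;> simp only <;> omega
  · intro t _; rfl

theorem dilogSum_reflect_middle (Z : ℕ → ℕ → ℕ → ℝ) :
    dilogSum n (fun a b c => Z a (a + c - b) c) = dilogSum n Z := by
  refine Finset.sum_nbij' (fun t => (t.1, t.1 + t.2.2 - t.2.1, t.2.2))
    (fun t => (t.1, t.1 + t.2.2 - t.2.1, t.2.2)) ?_ ?_ ?_ ?_ ?_
  · intro t ht; rw [mem_T] at ht ⊢; simp only; omega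
  · intro t ht; rw [mem_T] at ht ⊢; simp only; omega
  · intro t ht; rw [mem_T] at ht; ext <;> simp only; omega
  · intro t ht; rw [mem_T] at ht; ext <;> simp only; omega
  · intro t _; rfl

theorem dilogSum_Ylow_eq_Ytlow {G : Matrix (Fin n) (Fin n) ℝ} (hG : G ∈ BPlus n) :
    dilogSum n (Ylow G) = dilogSum n (Ytlow G) := by
  rw [dilogSum_congr fun a b c h1 h2 h3 _ => Ylow_eq_exchangeRatio G h1 h2 h3,
    dilogSum_congr fun a b c h1 h2 h3 _ => Ytlow_eq_exchangeRatio G h1 h2 h3]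
  exact sum_ell_exchangeRatio_pathSet (fun S => rightMinor_pos hG _) (threeTerm_rightMinor G)

theorem dilogSumInv_Yup_eq_Ytup {G : Matrix (Fin n) (Fin n) ℝ} (hG : G ∈ BPlus n) :
    dilogSumInv n (Yup G) = dilogSumInv n (Ytup G) := by
  rw [dilogSumInv_eq, dilogSumInv_eq,
    dilogSum_congr fun a b c h1 h2 h3 _ => one_div_Yup_eq_exchangeRatio G h1 h2 h3,
    dilogSum_congr fun a b c h1 h2 h3 _ => one_div_Ytup_eq_exchangeRatio G h1 h2 h3]
  exact sum_ell_exchangeRatio_pathSet (fun S => upperMinor_pos hG _) (threeTerm_upperMinor G)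

theorem entry_diag_ne_zero {G : Matrix (Fin n) (Fin n) ℝ} (hG : G ∈ B n) {i : ℕ} (hi : i < n) :
    entry G i i ≠ 0 := by
  have h := (Matrix.isUnit_iff_isUnit_det _).1 hG.2
  rw [det_of_upper hG.1, isUnit_iff_ne_zero, Finset.prod_ne_zero_iff] at h
  have := h ⟨i, hi⟩ (Finset.mem_univ _)
  simpa [entry, hi] using this

theorem prod_entry_ne_zero {G : Matrix (Fin n) (Fin n) ℝ} (hG : G ∈ B n) {a : ℕ} (ha : a ≤ n) :
    ∏ i ∈ Finset.range a, entry G i i ≠ 0 :=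
  Finset.prod_ne_zero_iff.2 fun _ hi =>
    entry_diag_ne_zero hG ((Finset.mem_range.1 hi).trans_le ha)

theorem mul_mul_div_mul_mul {p q : ℝ} (hp : p ≠ 0) (hq : q ≠ 0) (w x y z : ℝ) :
    p * w * (q * x) / (p * y * (q * z)) = w * x / (y * z) := by
  rw [mul_mul_mul_comm, mul_mul_mul_comm p y, mul_div_mul_left _ _ (mul_ne_zero hp hq)]

/-- All eight flag minors reduce to diagonal products times solid minors; the diagonal products
cancel within each ratio and the same four solid minors remain. -/
theorem Ylow_eq_Ytup {G : Matrix (Fin n) (Fin n) ℝ} (hG : G ∈ B n) {a b c : ℕ} (ha : 1 ≤ a)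
    (hab : a < b) (hbc : b < c) (hc : c ≤ n) : Ylow G a b c = Ytup G a (a + c - b) c := by
  have hU := hG.1
  unfold Ylow Ytup
  rw [rightMinor_seg_union_seg hU ha (by omega) (by omega) (by omega),
    rightMinor_seg_union_seg hU (by omega) (by omega) (by omega) (by omega),
    rightMinor_seg_union_seg hU ha (by omega) (by omega) (by omega),
    rightMinor_seg_union_seg hU (by omega) (by omega) (by omega) (by omega),
    upperMinor_seg_union_seg hU (by omega) (by omega) (by omega),
    upperMinor_seg_union_seg hU (by omega) (by omega) (by omega),
    upperMinor_seg_union_seg hU (by omega) (by omega) (by omega),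
    upperMinor_seg_union_seg hU (by omega) (by omega) (by omega),
    mul_mul_div_mul_mul (prod_entry_ne_zero (anti_mem_B hG) (by omega))
      (prod_entry_ne_zero (anti_mem_B hG) (by omega)),
    mul_mul_div_mul_mul (prod_entry_ne_zero hG (by omega)) (prod_entry_ne_zero hG (by omega)),
    mul_comm (solidMinor G (a - 1) _ _)]
  congr 1
  · congr 2 <;> omega
  · rw [mul_comm]
    congr 2 <;> omega

theorem dilogSum_Ylow_eq_Ytup {G : Matrix (Fin n) (Fin n) ℝ} (hG : G ∈ BPlus n) :
    dilogSum n (Ylow G) = dilogSum n (Ytup G) := by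
  rw [← dilogSum_reflect_middle (Ytup G)]
  exact dilogSum_congr fun a b c h1 h2 h3 h4 => Ylow_eq_Ytup hG.1 h1 h2 h3 h4

/-- The four dilogarithm sums of a totally positive matrix agree, and so do the four sums of
the inverse ratios. -/
theorem dilogSum_all_eq {G : Matrix (Fin n) (Fin n) ℝ} (hG : G ∈ BPlus n) :
    (dilogSum n (Ytlow G) = dilogSum n (Ylow G) ∧ dilogSum n (Ytup G) = dilogSum n (Ylow G) ∧
      dilogSum n (Yup G) = dilogSum n (Ylow G)) ∧
    (dilogSumInv n (Ytlow G) = dilogSumInv n (Ylow G) ∧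
      dilogSumInv n (Ytup G) = dilogSumInv n (Ylow G) ∧
      dilogSumInv n (Yup G) = dilogSumInv n (Ylow G)) := by
  obtain ⟨C, hC⟩ := exists_dilogSum_reflection n
  have hR := rightMinor_pos hG
  have hU := upperMinor_pos hG
  have p1 := hC (Ylow G) fun a b c => div_pos (mul_pos (hR _) (hR _)) (mul_pos (hR _) (hR _))
  have p2 := hC (Ytlow G) fun a b c => div_pos (mul_pos (hR _) (hR _)) (mul_pos (hR _) (hR _))
  have p3 := hC (Yup G) fun a b c => div_pos (mul_pos (hU _) (hU _)) (mul_pos (hU _) (hU _))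
  have p4 := hC (Ytup G) fun a b c => div_pos (mul_pos (hU _) (hU _)) (mul_pos (hU _) (hU _))
  have e1 := dilogSum_Ylow_eq_Ytlow hG
  have e2 := dilogSumInv_Yup_eq_Ytup hG
  have e3 := dilogSum_Ylow_eq_Ytup hG
  refine ⟨⟨?_, ?_, ?_⟩, ?_, ?_, ?_⟩ <;> linarith

/-- Reversing labels turns [a, b-1] ∪ [c+1, n] into [1, a'-1] ∪ [b'+1, c'] with (a', b', c') =
(n+1-c, n+1-b, n+1-a), and similarly for the other three sets: numerators of Y become denominators
of Ỹ. -/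
theorem IsCheck.dilogSum_Ylow {G H : Matrix (Fin n) (Fin n) ℝ} (h : IsCheck G H) :
    dilogSum n (Ylow H) = dilogSumInv n (Ytlow G) := by
  rw [dilogSumInv_eq, ← dilogSum_reverse fun a b c => 1 / Ytlow G a b c]
  refine dilogSum_congr fun a b c h1 h2 h3 h4 => ?_
  rw [Ylow, Ytlow, one_div_div, mul_comm (rightMinor H (seg n a b ∪ _)),
    mul_comm (rightMinor H (seg n a (b - 1) ∪ _)), h.2, h.2, h.2, h.2]
  congr 3 <;> ext x <;> have := x.2 <;>
    simp only [mem_bar, Finset.mem_union, mem_seg, Fin.val_rev] <;> omega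

theorem IsHat.dilogSum_Ytup {G H : Matrix (Fin n) (Fin n) ℝ} (h : IsHat G H) :
    dilogSum n (Ytup H) = dilogSumInv n (Yup G) := by
  rw [dilogSumInv_eq, ← dilogSum_reverse fun a b c => 1 / Yup G a b c]
  refine dilogSum_congr fun a b c h1 h2 h3 h4 => ?_
  rw [Ytup, Yup, one_div_div, mul_comm (upperMinor H (seg n 1 a ∪ seg n b (c - 1))),
    mul_comm (upperMinor H (seg n 1 a ∪ seg n (b + 1) (c - 1))), h.2, h.2, h.2, h.2]
  congr 3 <;> ext x <;> have := x.2 <;>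
    simp only [mem_bar, Finset.mem_union, mem_seg, Fin.val_rev] <;> omega

end TotPosDilog

/-! ### Total positivity from positivity of the upper flag minors. -/

namespace TotPosDilog

open Matrix

variable {n : ℕ}

section Criterion

/-- The columns of `H` with (zero-based) labels `c 0, c 1, …`, continued by zero. -/
noncomputable def colFn (H : Matrix (Fin n) (Fin n) ℝ) (c : ℕ → ℕ) (t : ℕ) (x : Fin n) : ℝ :=
  entry H x (c t)

/-- The rows in `I` lie weakly above the first `k` columns labelled by `c`, expressed through
counting functions. -/
def Dominated (k : ℕ) (c : ℕ → ℕ) (I : Finset (Fin n)) : Prop :=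
  ∀ x : ℕ, (∑ t ∈ Finset.range k, if c t ≤ x then 1 else 0) ≤ (I.filter fun i : Fin n => (i : ℕ) ≤ x).card

theorem entry_eq_zero {H : Matrix (Fin n) (Fin n) ℝ} (hH : ∀ i j : Fin n, j < i → H i j = 0)
    {i j : ℕ} (hij : j < i) : entry H i j = 0 := by
  unfold entry
  split_ifs with h
  · exact hH _ _ (by simpa [Fin.lt_def] using hij)
  · rfl

theorem flagMinor_colFn_eq_zero {H : Matrix (Fin n) (Fin n) ℝ}
    (hH : ∀ i j : Fin n, j < i → H i j = 0) {k : ℕ} {c : ℕ → ℕ} {I : Finset (Fin n)}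
    (hk : I.card = k) (hd : ¬ Dominated k c I) : flagMinor (colFn H c) I = 0 := by
  subst hk
  rw [flagMinor, Matrix.det_apply]
  refine Finset.sum_eq_zero fun σ _ => ?_
  by_cases hz : ∃ i : Fin I.card, c (σ i) < (I.orderEmbOfFin rfl i : ℕ)
  · obtain ⟨i, hi⟩ := hz
    rw [Finset.prod_eq_zero (Finset.mem_univ i), smul_zero]
    exact entry_eq_zero hH hi
  · refine absurd (fun x => ?_) hd
    push Not at hz
    rw [← Fin.sum_univ_eq_sum_range (fun t => if c t ≤ x then 1 else 0) I.card,
      ← Finset.card_filter]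
    -- A permutation whose factors all lie on or above the diagonal injects the columns up to x into
    -- the rows up to x, which is domination.
    refine Finset.card_le_card_of_injOn (fun t => I.orderEmbOfFin rfl (σ.symm t)) ?_ ?_
    · intro t ht
      have h := hz (σ.symm t)
      simp only [Finset.coe_filter, Finset.mem_univ, true_and, Set.mem_ofPred_eq] at ht ⊢
      rw [Equiv.apply_symm_apply] at h
      exact ⟨Finset.orderEmbOfFin_mem _ _ _, h.trans ht⟩
    · intro s _ t _ hst
      exact σ.symm.injective ((I.orderEmbOfFin rfl).injective hst)

theorem sum_range_shift {k : ℕ} {c : ℕ → ℕ} {x : ℕ} :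
    (∑ t ∈ Finset.range (k + 1), if c t ≤ x then 1 else 0) =
      (∑ t ∈ Finset.range k, if c (t + 1) ≤ x then 1 else 0) + if c 0 ≤ x then 1 else 0 :=
  Finset.sum_range_succ' _ _

/-- Adjoining the first a rows and columns gives an upper flag minor, which differs from the minor
in question by a positive product of diagonal entries. -/
theorem flagMinor_colFn_seg_pos {H : Matrix (Fin n) (Fin n) ℝ}
    (hH : ∀ i j : Fin n, j < i → H i j = 0) (hpos : ∀ J, 0 < upperMinor H J) {k a : ℕ}
    {c : ℕ → ℕ} (hak : a + k ≤ n) (hc : ∀ s t, s < t → t < k → c s < c t) (hcn : ∀ t < k, c t < n)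
    (hac : ∀ t < k, a ≤ c t) : 0 < flagMinor (colFn H c) (seg n (a + 1) (a + k)) := by
  have hD : 0 < ∏ i ∈ Finset.range a, entry H i i := by
    have h := upperMinor_seg_union hH a (by omega) ∅ (by simp)
    have e : ∀ φ : ℕ → Fin n → ℝ, flagMinor φ ∅ = 1 := fun φ => by
      rw [flagMinor_eq_det φ (k := 0) (fun i => i.elim0) (fun i => i.elim0)
        (fun x => by simp)]
      simp
    rw [e, mul_one] at h
    rw [← h]
    exact hpos _
  let f : Fin k → Fin n := fun t => ⟨c t, hcn t t.2⟩
  have hf : StrictMono f := fun s t hst => hc s t hst t.2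
  have h := upperMinor_seg_union hH a (by omega) (Finset.univ.image f) (by
    intro x hx
    obtain ⟨t, -, rfl⟩ := Finset.mem_image.1 hx
    exact hac t t.2)
  have hp := hpos (seg n 1 a ∪ Finset.univ.image f)
  rw [h, flagMinor_eq_det _ f hf (by simp)] at hp
  have hp' := pos_of_mul_pos_right hp hD.le
  rw [flagMinor_eq_det _ (k := k) (fun i => (⟨a + i, by omega⟩ : Fin n)), ← Matrix.det_transpose]
  · refine hp'.trans_eq (congrArg Matrix.det ?_)
    ext i j
    have h1 : a + (i : ℕ) < n := by omega
    have h2 : c j < n := hcn j j.2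
    simp [colFn, entry, rowFn, h1, h2, f]
  · intro i j hij
    simpa using hij
  · intro x
    rw [mem_seg]
    constructor
    · intro h
      exact ⟨⟨(x : ℕ) - a, by omega⟩, by simp only [Fin.ext_iff]; omega⟩
    · rintro ⟨i, rfl⟩
      simp only
      omega

theorem card_filter_insert {S : Finset (Fin n)} {a : Fin n} (ha : a ∉ S) (x : ℕ) :
    ((insert a S).filter fun i : Fin n => (i : ℕ) ≤ x).card =
      (S.filter fun i : Fin n => (i : ℕ) ≤ x).card + if (a : ℕ) ≤ x then 1 else 0 := by
  rw [Finset.filter_insert]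
  split_ifs with h
  · rw [Finset.card_insert_of_notMem (by simp [ha])]
  · rfl

/-- Double induction on the size k and on the length of a window containing the rows. Consecutive
rows are the base case. Otherwise the smallest row a, the largest row b and a missing row g between
them enter a three-term relation whose other minors are smaller or have a shorter window. -/
theorem flagMinor_colFn_pos {H : Matrix (Fin n) (Fin n) ℝ}
    (hH : ∀ i j : Fin n, j < i → H i j = 0) (hpos : ∀ J, 0 < upperMinor H J) (k : ℕ) :
    ∀ c : ℕ → ℕ, (∀ s t, s < t → t < k → c s < c t) → (∀ t < k, c t < n) →
      ∀ I : Finset (Fin n), I.card = k → Dominated k c I → 0 < flagMinor (colFn H c) I := by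
  induction k with
  | zero =>
    intro c _ _ I hI _
    rw [Finset.card_eq_zero] at hI
    subst hI
    rw [flagMinor_eq_det _ (k := 0) (fun i => i.elim0) (fun i => i.elim0) (fun x => by simp)]
    simp
  | succ k ih =>
    intro c hc hcn
    have main : ∀ d lo : ℕ, ∀ I : Finset (Fin n), (∀ x ∈ I, lo ≤ (x : ℕ) ∧ (x : ℕ) ≤ lo + d) →
        I.card = k + 1 → Dominated (k + 1) c I → 0 < flagMinor (colFn H c) I := by
      have hfull : ∀ d lo : ℕ, ∀ I : Finset (Fin n),
          (∀ x ∈ I, lo ≤ (x : ℕ) ∧ (x : ℕ) ≤ lo + d) →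
          (∀ y, lo ≤ y → y ≤ lo + d → ∃ h : y < n, (⟨y, h⟩ : Fin n) ∈ I) →
          I.card = k + 1 → Dominated (k + 1) c I → 0 < flagMinor (colFn H c) I := by
        intro d lo I hI hf hcard hdom
        have hmap : I.map Fin.valEmbedding = Finset.Icc lo (lo + d) := by
          ext y
          simp only [Finset.mem_map, Fin.valEmbedding_apply, Finset.mem_Icc]
          constructor
          · rintro ⟨x, hx, rfl⟩; exact hI x hx
          · rintro ⟨h1, h2⟩; obtain ⟨h, hy⟩ := hf y h1 h2; exact ⟨_, hy, rfl⟩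
        have hd : d = k := by
          have := congrArg Finset.card hmap
          rw [Finset.card_map, hcard, Nat.card_Icc] at this
          omega
        subst hd
        have hI' : I = seg n (lo + 1) (lo + (d + 1)) := by
          ext x
          rw [mem_seg]
          constructor
          · intro hx; have := hI x hx; omega
          · intro hx; obtain ⟨_, hy⟩ := hf x (by omega) (by omega); exact hy
        have hlo : lo ≤ c 0 := by
          have h := hdom (c 0)
          rw [sum_range_shift, if_pos le_rfl] at h
          have hne : 0 < (I.filter fun i : Fin n => (i : ℕ) ≤ c 0).card := by omega
          obtain ⟨x, hx⟩ := Finset.card_pos.1 hne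
          rw [Finset.mem_filter] at hx
          exact (hI x hx.1).1.trans hx.2
        obtain ⟨hn, -⟩ := hf (lo + d) (by omega) le_rfl
        rw [hI']
        refine flagMinor_colFn_seg_pos hH hpos (by omega) hc hcn fun t ht => ?_
        rcases Nat.eq_zero_or_pos t with rfl | h0
        · exact hlo
        · exact hlo.trans (hc 0 t h0 ht).le
      intro d
      induction d with
      | zero =>
        intro lo I hI hcard hdom
        obtain ⟨x, hx⟩ := Finset.card_pos.1 (by rw [hcard]; omega : 0 < I.card)
        refine hfull 0 lo I hI (fun y h1 h2 => ⟨by have := hI x hx; omega, ?_⟩) hcard hdom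
        have : (⟨y, by have := hI x hx; omega⟩ : Fin n) = x := by
          have := hI x hx
          rw [Fin.ext_iff]; simp only; omega
        rw [this]; exact hx
      | succ d ihd =>
        intro lo I hI hcard hdom
        by_cases hlo : ∃ x ∈ I, (x : ℕ) = lo
        swap
        · refine ihd (lo + 1) I (fun x hx => ?_) hcard hdom
          have h1 := hI x hx
          have h2 : (x : ℕ) ≠ lo := fun h => hlo ⟨x, hx, h⟩
          omega
        by_cases hhi : ∃ x ∈ I, (x : ℕ) = lo + (d + 1)
        swap
        · refine ihd lo I (fun x hx => ?_) hcard hdom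
          have h1 := hI x hx
          have h2 : (x : ℕ) ≠ lo + (d + 1) := fun h => hhi ⟨x, hx, h⟩
          omega
        by_cases hgap : ∀ y, lo ≤ y → y ≤ lo + (d + 1) → ∃ h : y < n, (⟨y, h⟩ : Fin n) ∈ I
        · exact hfull (d + 1) lo I hI hgap hcard hdom
        push Not at hgap
        obtain ⟨a, haI, ha⟩ := hlo
        obtain ⟨b, hbI, hb⟩ := hhi
        obtain ⟨y, hy1, hy2, hy⟩ := hgap
        have hyn : y < n := by have := b.2; omega
        obtain ⟨g, hg⟩ : ∃ g : Fin n, g = ⟨y, hyn⟩ := ⟨_, rfl⟩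
        have hgy : (g : ℕ) = y := by rw [hg]
        have hgI : g ∉ I := hg ▸ hy hyn
        have hag : a < g := by
          refine lt_of_le_of_ne (by rw [Fin.le_def]; omega) ?_
          rintro rfl; exact hgI haI
        have hgb : g < b := by
          refine lt_of_le_of_ne (by rw [Fin.le_def]; omega) ?_
          rintro rfl; exact hgI hbI
        have hab : a < b := hag.trans hgb
        set S := (I.erase a).erase b with hS
        have hbI' : b ∈ I.erase a := Finset.mem_erase.2 ⟨hab.ne', hbI⟩
        have hbS : b ∉ S := Finset.notMem_erase _ _
        have haS : a ∉ S := fun h => Finset.notMem_erase a I (Finset.mem_of_mem_erase h)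
        have hgS : g ∉ S := fun h => hgI (Finset.mem_of_mem_erase (Finset.mem_of_mem_erase h))
        have hIS : I = insert a (insert b S) := by
          rw [hS, Finset.insert_erase hbI', Finset.insert_erase haI]
        have hSI : ∀ x ∈ S, lo < (x : ℕ) ∧ (x : ℕ) < lo + (d + 1) := by
          intro x hx
          have h1 := hI x (Finset.mem_of_mem_erase (Finset.mem_of_mem_erase hx))
          have h2 : (x : ℕ) ≠ a := fun h => haS (Fin.ext h ▸ hx)
          have h3 : (x : ℕ) ≠ b := fun h => hbS (Fin.ext h ▸ hx)
          omega
        have habS : a ∉ insert b S := by simp [haS, hab.ne]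
        have hagS : a ∉ insert g S := by simp [haS, hag.ne]
        have hgbS : g ∉ insert b S := by simp [hgS, hgb.ne]
        have hSc : S.card + 1 = k := by
          have := hcard
          rw [hIS, Finset.card_insert_of_notMem habS, Finset.card_insert_of_notMem hbS] at this
          omega
        obtain ⟨m, rfl⟩ : ∃ m, k = m + 1 := ⟨S.card, hSc.symm⟩
        have hSm : S.card = m := by omega
        have hag' : (a : ℕ) < g := hag
        have hgb' : (g : ℕ) < b := hgb
        have cnt : ∀ x : ℕ, (∑ t ∈ Finset.range (m + 1), if c (t + 1) ≤ x then 1 else 0) +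
            (if c 0 ≤ x then 1 else 0) ≤ (S.filter fun i : Fin n => (i : ℕ) ≤ x).card +
              (if (b : ℕ) ≤ x then 1 else 0) + if (a : ℕ) ≤ x then 1 else 0 := by
          intro x
          have h := hdom x
          rwa [sum_range_shift, hIS, card_filter_insert habS, card_filter_insert hbS] at h
        have hac : (a : ℕ) ≤ c 0 := by
          by_contra hlt
          have h := cnt (c 0)
          have hS0 : (S.filter fun i : Fin n => (i : ℕ) ≤ c 0).card = 0 := by
            rw [Finset.card_eq_zero, Finset.filter_eq_empty_iff]
            intro x hx
            have := hSI x hx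
            omega
          rw [if_pos le_rfl, if_neg (by omega), if_neg (by omega), hS0] at h
          omega
        have hSx : ∀ x, (b : ℕ) ≤ x → (S.filter fun i : Fin n => (i : ℕ) ≤ x).card = m := by
          intro x hx
          rw [Finset.filter_true_of_mem, hSm]
          intro i hi
          have := hSI i hi
          omega
        have hcx : ∀ x, (∑ t ∈ Finset.range (m + 1), if c (t + 1) ≤ x then 1 else 0) ≤ m + 1 := by
          intro x
          refine (Finset.sum_le_card_nsmul _ _ 1 fun t _ => ?_).trans (by simp)
          split_ifs <;> simp
        have hc0 : ∀ x, x < c 0 →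
            (∑ t ∈ Finset.range (m + 1), if c (t + 1) ≤ x then 1 else 0) = 0 := by
          intro x hx
          refine Finset.sum_eq_zero fun t ht => if_neg ?_
          have := hc 0 (t + 1) (by omega) (by simpa using ht)
          omega
        -- Domination survives dropping the column c 0: nothing is to be counted below c 0, all rows
        -- count from b on, and in between the dropped column pays for the row a, the only one of a,
        -- b counted there.
        have small : ∀ z : Fin n, z ∉ S → z = a ∨ z = g ∨ z = b →
            0 < flagMinor (fun t => colFn H c (t + 1)) (insert z S) := by
          intro z hz hzz
          refine ih (fun t => c (t + 1)) (fun s t hst ht => hc _ _ (by omega) (by omega))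
            (fun t ht => hcn _ (by omega)) _ (by rw [Finset.card_insert_of_notMem hz, hSm]) ?_
          intro x
          change (∑ t ∈ Finset.range (m + 1), if c (t + 1) ≤ x then 1 else 0) ≤ _
          rw [card_filter_insert hz]
          have h1 := cnt x
          have h2 := hSx x
          have h3 := hcx x
          have h4 := hc0 x
          have hzb : (z : ℕ) ≤ b := by
            rcases hzz with rfl | rfl | rfl
            · exact hab.le
            · exact hgb.le
            · exact le_rfl
          by_cases hx0 : x < c 0
          · rw [h4 hx0]; exact Nat.zero_le _
          by_cases hbx : (b : ℕ) ≤ x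
          · rw [if_pos (hzb.trans hbx), h2 hbx]; exact h3
          · rw [if_pos (by omega), if_neg hbx] at h1
            split_ifs at h1 ⊢ <;> omega
        have hcardI : ∀ u v : Fin n, u ∉ insert v S → v ∉ S →
            (insert u (insert v S)).card = m + 1 + 1 := fun u v hu hv => by
          rw [Finset.card_insert_of_notMem hu, Finset.card_insert_of_notMem hv, hSm]
        have pos1 : 0 < flagMinor (colFn H c) (insert a (insert g S)) := by
          refine ihd lo _ (fun x hx => ?_) (hcardI _ _ hagS hgS) ?_
          · rw [Finset.mem_insert, Finset.mem_insert] at hx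
            rcases hx with rfl | rfl | hx
            · omega
            · omega
            · have := hSI x hx; omega
          · intro x
            rw [card_filter_insert hagS, card_filter_insert hgS, sum_range_shift]
            have h1 := cnt x
            split_ifs at h1 ⊢ <;> omega
        -- Replacing a by the larger g may destroy domination, in which case the minor is zero; the
        -- other summand is strictly positive anyway.
        have nonneg2 : 0 ≤ flagMinor (colFn H c) (insert g (insert b S)) := by
          by_cases hd' : Dominated (m + 1 + 1) c (insert g (insert b S))
          · refine (ihd (lo + 1) _ (fun x hx => ?_) (hcardI _ _ hgbS hbS) hd').le
            rw [Finset.mem_insert, Finset.mem_insert] at hx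
            rcases hx with rfl | rfl | hx
            · omega
            · omega
            · have := hSI x hx; omega
          · exact (flagMinor_colFn_eq_zero hH (hcardI _ _ hgbS hbS) hd').ge
        -- Here the first column is omitted, not the last.
        have rel := flagMinor_threeTerm (φ := colFn H c) (ψ := fun t => colFn H c (t + 1)) hSm 0
          (fun t x => by simp) hag hgb haS hgS hbS
        have q1 := mul_pos (small b hbS (Or.inr (Or.inr rfl))) pos1
        have q2 := mul_nonneg (small a haS (Or.inl rfl)).le nonneg2
        rw [hIS]
        exact pos_of_mul_pos_right (by rw [rel]; linarith) (small g hgS (Or.inr (Or.inl rfl))).le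
    intro I hI hdom
    exact main n 0 I (fun x _ => ⟨Nat.zero_le _, by omega⟩) hI hdom

/-- Positivity of the flag minors implies total positivity. -/
theorem mem_BPlus_of_upperMinor_pos {H : Matrix (Fin n) (Fin n) ℝ} (hH : H ∈ B n)
    (hpos : ∀ J, 0 < upperMinor H J) : H ∈ BPlus n := by
  refine ⟨hH, fun k r c => ?_⟩
  rintro ⟨H', hH', hdet⟩
  -- The value 0 beyond k is never read by a minor of size k.
  let c' : ℕ → ℕ := fun t => if h : t < k then (c ⟨t, h⟩ : ℕ) else 0
  have key : ∀ M : Matrix (Fin n) (Fin n) ℝ, (M.submatrix r c).det =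
      flagMinor (colFn M c') (Finset.univ.image r) := by
    intro M
    rw [flagMinor_eq_det _ r r.strictMono (by simp), ← Matrix.det_transpose]
    congr 1
    ext i j
    simp [colFn, c', entry]
  have hcard : (Finset.univ.image r).card = k := by
    rw [Finset.card_image_of_injective _ r.injective]; simp
  rw [key]
  refine flagMinor_colFn_pos hH.1 hpos k c' ?_ ?_ _ hcard ?_
  · intro s t hst ht
    have hs : s < k := hst.trans ht
    simp only [c', hs, ht, dif_pos]
    exact c.strictMono (by simpa using hst)
  · intro t ht
    simp only [c', ht, dif_pos]
    exact (c _).2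
  · by_contra hd
    rw [key] at hdet
    exact hdet (flagMinor_colFn_eq_zero hH'.1 hcard hd)

end Criterion

end TotPosDilog

/-! ### Existence and uniqueness of Ĝ and Ǧ. -/

namespace TotPosDilog

open Matrix

variable {n : ℕ}

/-- A lower unipotent change of the rows does not affect the flag minors. -/
theorem flagMinor_rowOp {α : Type*} [LinearOrder α] {φ ψ : ℕ → α → ℝ} {J : Finset α}
    (L : ℕ → ℕ → ℝ) (hL : ∀ t < J.card, L t t = 1)
    (hψ : ∀ t < J.card, ∀ x, ψ t x = ∑ l ∈ Finset.range (t + 1), L t l * φ l x) :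
    flagMinor ψ J = flagMinor φ J := by
  set Λ : Matrix (Fin J.card) (Fin J.card) ℝ :=
    Matrix.of fun i l => if (l : ℕ) < i + 1 then L i l else 0 with hΛ
  have hdet : Λ.det = 1 := by
    rw [det_of_lower]
    · exact Finset.prod_eq_one fun i _ => by simp [hΛ, hL i i.2]
    · intro i j hij
      rw [hΛ, Matrix.of_apply, if_neg]
      rw [Fin.lt_def] at hij
      omega
  have hmul : (Matrix.of fun i j : Fin J.card => ψ i (J.orderEmbOfFin rfl j)) =
      Λ * Matrix.of fun i j : Fin J.card => φ i (J.orderEmbOfFin rfl j) := by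
    ext i j
    rw [Matrix.mul_apply, Matrix.of_apply, hψ i i.2]
    simp only [hΛ, Matrix.of_apply]
    rw [Fin.sum_univ_eq_sum_range (fun l => (if l < (i : ℕ) + 1 then L i l else 0) *
      φ l (J.orderEmbOfFin rfl j)) J.card]
    simp only [ite_mul, zero_mul]
    rw [← Finset.sum_filter]
    refine Finset.sum_congr ?_ fun _ _ => rfl
    ext l
    simp only [Finset.mem_range, Finset.mem_filter]
    omega
  rw [flagMinor, hmul, Matrix.det_mul, hdet, one_mul, flagMinor]

/-- Elimination of the entries left of the diagonal in one row. -/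
theorem exists_rowOp_row (φ : ℕ → Fin n → ℝ) {t : ℕ} (ht : t < n)
    (hD : (Matrix.of fun i j : Fin t => φ i ⟨j, by omega⟩).det ≠ 0) :
    ∃ w : ℕ → ℝ, w t = 1 ∧
      ∀ x : Fin n, (x : ℕ) < t → ∑ l ∈ Finset.range (t + 1), w l * φ l x = 0 := by
  set D := (Matrix.of fun i j : Fin t => φ i ⟨j, by omega⟩).det with hDdef
  -- The weights are the cofactors along a last column appended to the first t columns, normalized
  -- by the leading minor D so that w t = 1. The resulting sum is a determinant over D, and it
  -- vanishes when the appended column repeats an earlier one.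
  let w : ℕ → ℝ := fun l => if h : l < t + 1 then (-1) ^ (l + t) *
    (Matrix.of fun i j : Fin t => φ ((⟨l, h⟩ : Fin (t + 1)).succAbove i) ⟨j, by omega⟩).det / D
    else 0
  refine ⟨w, ?_, fun x hx => ?_⟩
  · have h1 : t < t + 1 := by omega
    have h2 : (⟨t, h1⟩ : Fin (t + 1)) = Fin.last t := rfl
    simp only [w, h1, dif_pos, h2, Fin.succAbove_last, Fin.val_castSucc]
    rw [Even.neg_one_pow ⟨t, rfl⟩, one_mul, div_self hD]
  · let A : Matrix (Fin (t + 1)) (Fin (t + 1)) ℝ :=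
      Matrix.of fun l m => φ l (if h : (m : ℕ) < t then ⟨m, by omega⟩ else x)
    have hA : A.det = 0 := by
      refine Matrix.det_zero_of_column_eq (i := ⟨x, by omega⟩) (j := Fin.last t) ?_ ?_
      · simp only [ne_eq, Fin.ext_iff, Fin.val_last]; omega
      · intro l
        simp [A, hx]
    rw [Matrix.det_succ_column A (Fin.last t)] at hA
    rw [← Fin.sum_univ_eq_sum_range (fun l => w l * φ l x) (t + 1)]
    rw [← mul_right_inj' hD, mul_zero, Finset.mul_sum, ← hA]
    refine Finset.sum_congr rfl fun l _ => ?_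
    have hl := l.2
    have e : A.submatrix l.succAbove (Fin.last t).succAbove =
        Matrix.of fun i j : Fin t => φ (l.succAbove i) ⟨j, by omega⟩ := by
      ext i j
      simp [A]
    rw [e]
    simp only [w, hl, dif_pos, A, Matrix.of_apply, Fin.val_last, lt_irrefl]
    field_simp
    simp

/-- A sign sequence whose partial products are the signs of the order-reversing
permutations. -/
noncomputable def revSign (k : ℕ) : ℝ :=
  ((Equiv.Perm.sign (Fin.revPerm : Equiv.Perm (Fin k)) : ℤ) : ℝ)

theorem revSign_mul_self (k : ℕ) : revSign k * revSign k = 1 := by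
  unfold revSign
  rw [← Int.cast_mul, ← Units.val_mul, Int.units_mul_self]
  simp

theorem prod_revSign (k : ℕ) :
    ∏ t ∈ Finset.range k, revSign (t + 1) * revSign t = revSign k := by
  induction k with
  | zero => simp [revSign, Subsingleton.elim (Fin.revPerm : Equiv.Perm (Fin 0)) 1]
  | succ k ih =>
    rw [Finset.prod_range_succ, ih, mul_left_comm, revSign_mul_self, mul_one]

/-- The rows of the signed matrix `G w₀`. -/
noncomputable def revRow (G : Matrix (Fin n) (Fin n) ℝ) (t : ℕ) (x : Fin n) : ℝ :=
  revSign (t + 1) * revSign t * rowFn G t x.rev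

/-- The signs of the first k rows multiply to `revSign k`, which is exactly the sign of putting k
reversed columns back in order. -/
theorem flagMinor_revRow (G : Matrix (Fin n) (Fin n) ℝ) (J : Finset (Fin n)) :
    flagMinor (revRow G) J = upperMinor G (bar J) := by
  have h1 : flagMinor (revRow G) J = revSign J.card *
      (Matrix.of fun i j : Fin J.card => rowFn G i (J.orderEmbOfFin rfl j).rev).det := by
    have := Matrix.det_mul_column (fun i : Fin J.card => revSign (i + 1) * revSign i)
      (Matrix.of fun i j : Fin J.card => rowFn G i (J.orderEmbOfFin rfl j).rev)
    rw [Fin.prod_univ_eq_prod_range (fun t => revSign (t + 1) * revSign t), prod_revSign] at this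
    exact this
  rw [h1, upperMinor_eq_flagMinor,
    flagMinor_eq_det _ (k := J.card) (fun i => (J.orderEmbOfFin rfl i.rev).rev)]
  · have := Matrix.det_permute' Fin.revPerm
      (Matrix.of fun i j : Fin J.card => rowFn G i (J.orderEmbOfFin rfl j).rev)
    refine Eq.trans ?_ this.symm
    rfl
  · intro i j hij
    simpa using hij
  · intro x
    rw [mem_bar, ← Finset.mem_coe, ← Finset.range_orderEmbOfFin J rfl, Set.mem_range]
    constructor
    · rintro ⟨i, hi⟩
      exact ⟨i.rev, by simp [hi]⟩
    · rintro ⟨i, hi⟩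
      exact ⟨i.rev, by simp [← hi]⟩

/-- This is an LU factorization of the signed G w₀: its leading minors are flag minors of G, hence
nonzero, and the lower unipotent factor leaves all upper flag minors unchanged. -/
theorem exists_isHat {G : Matrix (Fin n) (Fin n) ℝ} (hG : G ∈ BPlus n) : ∃ H, IsHat G H := by
  have hrow : ∀ t : ℕ, ∃ w : ℕ → ℝ, t < n → w t = 1 ∧
      ∀ x : Fin n, (x : ℕ) < t → ∑ l ∈ Finset.range (t + 1), w l * revRow G l x = 0 := by
    intro t
    by_cases ht : t < n
    · obtain ⟨w, hw⟩ := exists_rowOp_row (revRow G) ht (by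
        have h := flagMinor_eq_det (revRow G) (J := seg n 1 t)
          (fun j : Fin t => (⟨j, by omega⟩ : Fin n)) (fun i j hij => by simpa using hij) (by
            intro x
            rw [mem_seg]
            constructor
            · intro h; exact ⟨⟨x, by omega⟩, rfl⟩
            · rintro ⟨i, rfl⟩; simp only; omega)
        rw [← h, flagMinor_revRow]
        exact (upperMinor_pos hG _).ne')
      exact ⟨w, fun _ => hw⟩
    · exact ⟨0, fun h => absurd h ht⟩
  choose L hL using hrow
  let ψ : ℕ → Fin n → ℝ := fun t x => ∑ l ∈ Finset.range (t + 1), L t l * revRow G l x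
  let H : Matrix (Fin n) (Fin n) ℝ := Matrix.of fun i j => ψ i j
  have hminor : ∀ J : Finset (Fin n), upperMinor H J = upperMinor G (bar J) := by
    intro J
    have hJ : J.card ≤ n := by simpa using J.card_le_univ
    rw [← flagMinor_revRow, upperMinor_eq_flagMinor]
    refine flagMinor_rowOp L (fun t ht => (hL t (by omega)).1) fun t ht x => ?_
    have : t < n := by omega
    simp [rowFn, this, H, ψ]
  have hpos : ∀ J, 0 < upperMinor H J := fun J => by
    rw [hminor]; exact upperMinor_pos hG _
  have hB : H ∈ B n := by
    refine ⟨fun i j hij => (hL i i.2).2 j hij, ?_⟩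
    rw [Matrix.isUnit_iff_isUnit_det, isUnit_iff_ne_zero]
    have h := hpos Finset.univ
    rw [upperMinor_eq_flagMinor, flagMinor_eq_det _ (k := n) id strictMono_id (by simp)] at h
    have e : (Matrix.of fun i j : Fin n => rowFn H i (id j)) = H := by
      ext i j; simp [rowFn_fin]
    rw [e] at h
    exact h.ne'
  exact ⟨H, mem_BPlus_of_upperMinor_pos hB hpos, hminor⟩

/-- Matrices in `B n` are determined by their upper flag minors. -/
theorem eq_of_upperMinor_eq {G H : Matrix (Fin n) (Fin n) ℝ} (hG : G ∈ B n) (hH : H ∈ B n)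
    (h : ∀ J, upperMinor G J = upperMinor H J) : G = H := by
  have e0 : ∀ φ : ℕ → Fin n → ℝ, flagMinor φ ∅ = 1 := fun φ => by
    rw [flagMinor_eq_det φ (k := 0) (fun i => i.elim0) (fun i => i.elim0) (fun x => by simp)]
    simp
  have hprod : ∀ a ≤ n, ∏ i ∈ Finset.range a, entry G i i = ∏ i ∈ Finset.range a, entry H i i := by
    intro a ha
    have h1 := h (seg n 1 a ∪ ∅)
    rwa [upperMinor_seg_union hG.1 a ha ∅ (by simp), upperMinor_seg_union hH.1 a ha ∅ (by simp),
      e0, e0, mul_one, mul_one] at h1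
  ext i j
  rcases lt_or_ge j i with hij | hij
  · rw [hG.1 i j hij, hH.1 i j hij]
  · have h1 := h (seg n 1 i ∪ {j})
    have hj : ∀ x ∈ ({j} : Finset (Fin n)), (i : ℕ) ≤ x := by
      intro x hx; rw [Finset.mem_singleton] at hx; subst hx; exact hij
    have e1 : ∀ M : Matrix (Fin n) (Fin n) ℝ,
        flagMinor (fun t => rowFn M (i + t)) {j} = M i j := fun M => by
      rw [flagMinor_eq_det _ (k := 1) (fun _ => j) (Subsingleton.strictMono _)
        (fun x => by simp [eq_comm])]
      simp [rowFn_fin]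
    rw [upperMinor_seg_union hG.1 i i.2.le _ hj, upperMinor_seg_union hH.1 i i.2.le _ hj,
      hprod i i.2.le, e1, e1] at h1
    exact mul_left_cancel₀ (prod_entry_ne_zero hH i.2.le) h1

theorem existsUnique_isHat {G : Matrix (Fin n) (Fin n) ℝ} (hG : G ∈ BPlus n) :
    ∃! H, IsHat G H := by
  obtain ⟨H, hH⟩ := exists_isHat hG
  refine ⟨H, hH, fun H' hH' => eq_of_upperMinor_eq hH'.1.1 hH.1.1 fun J => ?_⟩
  rw [hH.2, hH'.2]

theorem isCheck_iff_isHat_anti {G H : Matrix (Fin n) (Fin n) ℝ} :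
    IsCheck G H ↔ IsHat (anti G) (anti H) := by
  refine and_congr ⟨anti_mem_BPlus, fun h => by simpa [anti_anti] using anti_mem_BPlus h⟩ ?_
  simp only [rightMinor_eq_upperMinor]
  constructor
  · intro h J
    have := h (bar J)
    rwa [bar_bar] at this
  · intro h J
    exact h (bar J)

theorem existsUnique_isCheck {G : Matrix (Fin n) (Fin n) ℝ} (hG : G ∈ BPlus n) :
    ∃! H, IsCheck G H := by
  obtain ⟨H, hH, huniq⟩ := existsUnique_isHat (anti_mem_BPlus hG)
  refine ⟨anti H, isCheck_iff_isHat_anti.2 (by rwa [anti_anti]), fun H' hH' => ?_⟩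
  rw [← huniq _ (isCheck_iff_isHat_anti.1 hH'), anti_anti]

end TotPosDilog

theorem theorem3p9 (n : ℕ) (hn : 2 ≤ n) (G : Matrix (Fin n) (Fin n) ℝ)
    (hG : G ∈ TotPosDilog.BPlus n) :
    (∃! Gc, TotPosDilog.IsCheck G Gc) ∧
    (∃! Gh, TotPosDilog.IsHat G Gh) ∧
    ∀ Gc Gh : Matrix (Fin n) (Fin n) ℝ,
      TotPosDilog.IsCheck G Gc → TotPosDilog.IsHat G Gh →
      -- the chain of twelve equal sums, as eleven consecutive equalities
      TotPosDilog.dilogSum n (TotPosDilog.Ylow Gc) =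
        TotPosDilog.dilogSumInv n (TotPosDilog.Ylow G) ∧
      TotPosDilog.dilogSumInv n (TotPosDilog.Ylow G) =
        TotPosDilog.dilogSum n (TotPosDilog.Ylow Gh) ∧
      TotPosDilog.dilogSum n (TotPosDilog.Ylow Gh) =
        TotPosDilog.dilogSum n (TotPosDilog.Ytup Gc) ∧
      TotPosDilog.dilogSum n (TotPosDilog.Ytup Gc) =
        TotPosDilog.dilogSumInv n (TotPosDilog.Ytup G) ∧
      TotPosDilog.dilogSumInv n (TotPosDilog.Ytup G) =
        TotPosDilog.dilogSum n (TotPosDilog.Ytup Gh) ∧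
      TotPosDilog.dilogSum n (TotPosDilog.Ytup Gh) =
        TotPosDilog.dilogSum n (TotPosDilog.Ytlow Gc) ∧
      TotPosDilog.dilogSum n (TotPosDilog.Ytlow Gc) =
        TotPosDilog.dilogSumInv n (TotPosDilog.Ytlow G) ∧
      TotPosDilog.dilogSumInv n (TotPosDilog.Ytlow G) =
        TotPosDilog.dilogSum n (TotPosDilog.Ytlow Gh) ∧
      TotPosDilog.dilogSum n (TotPosDilog.Ytlow Gh) =
        TotPosDilog.dilogSum n (TotPosDilog.Yup Gc) ∧
      TotPosDilog.dilogSum n (TotPosDilog.Yup Gc) =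
        TotPosDilog.dilogSumInv n (TotPosDilog.Yup G) ∧
      TotPosDilog.dilogSumInv n (TotPosDilog.Yup G) =
        TotPosDilog.dilogSum n (TotPosDilog.Yup Gh) := by
  refine ⟨TotPosDilog.existsUnique_isCheck hG, TotPosDilog.existsUnique_isHat hG,
    fun Gc Gh hc hh => ?_⟩
  obtain ⟨-, g1, g2, g3⟩ := TotPosDilog.dilogSum_all_eq hG
  obtain ⟨⟨c1, c2, c3⟩, -⟩ := TotPosDilog.dilogSum_all_eq hc.1
  obtain ⟨⟨h1, h2, h3⟩, -⟩ := TotPosDilog.dilogSum_all_eq hh.1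
  have kc := hc.dilogSum_Ylow
  have kh := hh.dilogSum_Ytup
  refine ⟨?_, ?_, ?_, ?_, ?_, ?_, ?_, ?_, ?_, ?_, ?_⟩ <;> linarith
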